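/- Let $G$ be a finite simple planar graph, that is, a finite simple graph that can be drawn in the plane with its vertices as distinct points and its edges as simple polygonal arcs joining their end vertices, such that the interior of each edge contains no vertex and no point of another edge. Suppose that no two distinct triangles (cycles of length $3$) of $G$ have a common vertex, and that every triangle of $G$ shares an edge with at most one cycle of length $4$ of $G$. Then $\operatorname{mad}(G) < 4$, where $$\operatorname{mad}(G) = \max\left\{\frac{2|E(H)|}{|V(H)|} : H \text{ is a subgraph of } G \text{ with at least one vertex}\right\}$$ is the maximum average degree of $G$. -/

import Mathlib

namespace PlanarMad

/-- The real plane. Only its affine structure is used below. -/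
abbrev Plane : Type := ℝ × ℝ

/-- A simple polygonal arc in the plane: finitely many (at least one) straight line segments
`[pt 0, pt 1], [pt 1, pt 2], …, [pt (n-1), pt n]`, such that two different segments are disjoint,
except that consecutive segments share exactly their common end. -/
structure PolygonalArc where
  /-- the number of segments -/
  n : ℕ
  n_pos : 0 < n
  /-- the successive corners of the arc, including its two ends -/
  pt : Fin (n + 1) → Plane
  pt_injective : Function.Injective pt
  /-- A point on two segments `i < j` is the last point of `i` and the first point of `j`
  (so, `pt` being injective, `j` is the successor of `i`). -/
  simple : ∀ i j : Fin n, i < j →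
    ∀ x ∈ segment ℝ (pt i.castSucc) (pt i.succ), x ∈ segment ℝ (pt j.castSucc) (pt j.succ) →
      x = pt i.succ ∧ x = pt j.castSucc

/-- The set of points of a polygonal arc. -/
def PolygonalArc.carrier (A : PolygonalArc) : Set Plane :=
  ⋃ i : Fin A.n, segment ℝ (A.pt i.castSucc) (A.pt i.succ)

/-- The unordered pair of ends of a polygonal arc. -/
def PolygonalArc.ends (A : PolygonalArc) : Sym2 Plane :=
  s(A.pt 0, A.pt (Fin.last A.n))

/-- A drawing (embedding) of the graph `G` in the plane: the vertices are distinct points, every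
edge is a polygonal arc between its end vertices, the interior of an edge contains no vertex and no
point of any other edge. -/
structure PlaneDrawing {V : Type*} (G : SimpleGraph V) where
  /-- the point representing a vertex -/
  point : V → Plane
  point_injective : Function.Injective point
  /-- the arc representing an edge -/
  arc : G.edgeSet → PolygonalArc
  arc_ends : ∀ e : G.edgeSet, (arc e).ends = (e : Sym2 V).map point
  /-- an arc passes through no vertices other than its ends -/
  mem_of_point_mem_arc : ∀ (e : G.edgeSet) (v : V), point v ∈ (arc e).carrier → v ∈ (e : Sym2 V)
  /-- two different arcs meet only in common end vertices -/
  arc_inter : ∀ e f : G.edgeSet, e ≠ f → ∀ x ∈ (arc e).carrier, x ∈ (arc f).carrier →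
    ∃ v : V, v ∈ (e : Sym2 V) ∧ v ∈ (f : Sym2 V) ∧ x = point v

/-- A graph is planar if it can be drawn in the plane without crossings. -/
def IsPlanar {V : Type*} (G : SimpleGraph V) : Prop :=
  Nonempty (PlaneDrawing G)

/-- The subgraph `C` of `G` is a cycle of length `k`. -/
def IsCycleOfLength {V : Type*} {G : SimpleGraph V} (k : ℕ) (C : G.Subgraph) : Prop :=
  ∃ (u : V) (w : G.Walk u u), w.IsCycle ∧ w.length = k ∧ C = w.toSubgraph

/-- A triangle of `G` is a cycle of length three. -/
def IsTriangle {V : Type*} {G : SimpleGraph V} (C : G.Subgraph) : Prop :=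
  IsCycleOfLength 3 C

/-- Two cycles intersect if they have at least one common vertex. -/
def Intersecting {V : Type*} {G : SimpleGraph V} (C D : G.Subgraph) : Prop :=
  (C.verts ∩ D.verts).Nonempty

/-- Two cycles are adjacent if they share a common edge. -/
def Adjacent {V : Type*} {G : SimpleGraph V} (C D : G.Subgraph) : Prop :=
  (C.edgeSet ∩ D.edgeSet).Nonempty

/-- The average degree `2|E(H)| / |V(H)|` of a (finite) subgraph `H`. -/
noncomputable def averageDegree {V : Type*} {G : SimpleGraph V} (H : G.Subgraph) : ℝ :=
  2 * (H.edgeSet.ncard : ℝ) / (H.verts.ncard : ℝ)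

/-- The maximum average degree of a finite graph: the maximum (see `isGreatest_mad`) of the average
degrees of its subgraphs with at least one vertex. -/
noncomputable def mad {V : Type*} (G : SimpleGraph V) : ℝ :=
  sSup {d : ℝ | ∃ H : G.Subgraph, H.verts.Nonempty ∧ d = averageDegree H}

/-- For a finite graph with at least one vertex, the supremum in `mad` is a maximum. -/
theorem isGreatest_mad {V : Type*} [Finite V] [Nonempty V] (G : SimpleGraph V) :
    IsGreatest {d : ℝ | ∃ H : G.Subgraph, H.verts.Nonempty ∧ d = averageDegree H} (mad G) := by
  have hfin : {d : ℝ | ∃ H : G.Subgraph, H.verts.Nonempty ∧ d = averageDegree H}.Finite := by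
    refine (Set.finite_range fun H : G.Subgraph => averageDegree H).subset ?_
    rintro d ⟨H, -, rfl⟩
    exact ⟨H, rfl⟩
  have hne : {d : ℝ | ∃ H : G.Subgraph, H.verts.Nonempty ∧ d = averageDegree H}.Nonempty :=
    ⟨_, ⊤, Set.univ_nonempty, rfl⟩
  exact ⟨hne.csSup_mem hfin, fun d hd => le_csSup hfin.bddAbove hd⟩

end PlanarMad

-- It suffices to show |E| ≤ 2|V| - 2 for every nonempty plane graph satisfying the two cycle
-- conditions, since both conditions and the drawing pass to induced subgraphs. The proof is by
-- induction on |V| (`PlaneDrawing.ncard_edgeSet_add_two_le`). A cut with at most two edges splits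
-- the graph into two smaller ones, and (2a - 2) + (2b - 2) + 2 = 2(a + b) - 2.
--
-- If every cut has at least three edges, discharging over the faces applies
-- (`card_triangles_le_sum`). Across the edges of a triangular face lie three different faces, none
-- triangular and at most one of length four, so at least two have length at least five. A face of
-- length k ≥ 5 meets at most k/2 ≤ 2(k - 4) triangular faces along edges, because these have
-- disjoint vertex sets. Hence the triangular faces number at most the total excess over four of the
-- long faces, so 4|F| ≤ 2|E|, and |F| ≥ |E| - |V| + 2 gives |E| ≤ 2|V| - 4.
--
-- The faces are obtained algebraically (`PlaneDrawing.exists_faces`). Let W be the edge space over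
-- the field with two elements modulo the cut space. A point of the plane is labelled by the sum in
-- W of the classes of the edges above it. Edge classes sum to zero around each vertex, so the label
-- is constant along each side of an edge and jumps by the class of an edge across it. The labels
-- play the role of faces. Every label occurs an even number of times around a vertex, so boundaries
-- are even edge sets. Label differences span W, which yields the Euler inequality; the absence of
-- small cuts makes edge classes nonzero and distinct, so each edge bounds two faces and two faces
-- share at most one edge.

universe u

/-! ### Indicators modulo two -/

/-- The indicator of a proposition, with values in `ZMod 2`. -/
noncomputable def boolInd (P : Prop) : ZMod 2 := open Classical in if P then 1 else 0

theorem boolInd_true {P : Prop} (h : P) : boolInd P = 1 := if_pos h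

theorem boolInd_false {P : Prop} (h : ¬ P) : boolInd P = 0 := if_neg h

theorem boolInd_congr {P Q : Prop} (h : P ↔ Q) : boolInd P = boolInd Q := by rw [h]

theorem sum_boolInd_eq {α : Type*} (Q : Finset α) (a : α) :
    ∑ q ∈ Q, boolInd (a = q) = boolInd (a ∈ Q) := by
  by_cases h : a ∈ Q
  · rw [Finset.sum_eq_single_of_mem a h fun b _ hb => boolInd_false hb.symm, boolInd_true rfl,
      boolInd_true h]
  · rw [boolInd_false h]
    exact Finset.sum_eq_zero fun b hb => boolInd_false fun e => h (e ▸ hb)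

/-! ### Monotone arcs and the labels of the regions between them -/

/-- A family of `x`-monotone arcs, given as graphs of functions over compact intervals, two of
which meet at most in common end points. -/
structure MonotoneArcs (S : Type*) where
  left : S → ℝ
  right : S → ℝ
  height : S → ℝ → ℝ
  left_lt_right : ∀ s, left s < right s
  continuous_height : ∀ s, Continuous (height s)
  meet : ∀ s t, s ≠ t → ∀ x, left s ≤ x → x ≤ right s → left t ≤ x → x ≤ right t →
    height s x = height t x → (x = left s ∨ x = right s) ∧ (x = left t ∨ x = right t)

namespace MonotoneArcs

variable {S : Type*} (M : MonotoneArcs S)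

/-- The left end point of an arc. -/
def leftEnd (s : S) : ℝ × ℝ := (M.left s, M.height s (M.left s))

/-- The right end point of an arc. -/
def rightEnd (s : S) : ℝ × ℝ := (M.right s, M.height s (M.right s))

/-- The number (modulo two) of ends of the arc `s` at the point `v`. -/
noncomputable def inc (s : S) (v : ℝ × ℝ) : ZMod 2 :=
  boolInd (M.leftEnd s = v) + boolInd (M.rightEnd s = v)

/-- Two arcs without common points over an interval keep their relative position. -/
theorem height_lt_of_ne {s t : S} {x y : ℝ} (hne : ∀ z ∈ Set.uIcc x y, M.height s z ≠ M.height t z)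
    (h : M.height s x < M.height t x) : M.height s y < M.height t y := by
  by_contra hy
  have hc : ContinuousOn (fun z => M.height t z - M.height s z) (Set.uIcc x y) :=
    ((M.continuous_height t).sub (M.continuous_height s)).continuousOn
  have h0 : (0 : ℝ) ∈ Set.uIcc (M.height t x - M.height s x) (M.height t y - M.height s y) := by
    rw [Set.mem_uIcc]; right; constructor <;> linarith
  obtain ⟨z, hz, hz0⟩ := intermediate_value_uIcc hc h0
  exact hne z hz (by simp only at hz0; linarith)

theorem height_lt_iff_of_ne {s t : S} {x y : ℝ}
    (hne : ∀ z ∈ Set.uIcc x y, M.height s z ≠ M.height t z) :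
    M.height s x < M.height t x ↔ M.height s y < M.height t y :=
  ⟨M.height_lt_of_ne hne, M.height_lt_of_ne (by rwa [Set.uIcc_comm])⟩

/-- Between `v` and `x` the two arcs cannot meet: a meeting point at `v` would be an end of `t`, and
elsewhere it would be interior to `s`. So an arc not ending at `v` is above `s` near `v` exactly
when it is above `v`. -/
theorem height_lt_iff_of_end {s t : S} {v : ℝ × ℝ} {x : ℝ}
    (hs : M.leftEnd s = v ∨ M.rightEnd s = v) (hx : M.left s < x) (hx' : x < M.right s)
    (ht : M.leftEnd t ≠ v) (ht' : M.rightEnd t ≠ v) (h1 : M.left t ≤ v.1) (h2 : v.1 ≤ M.right t)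
    (h3 : M.left t ≤ x) (h4 : x ≤ M.right t) :
    M.height s x < M.height t x ↔ v.2 < M.height t v.1 := by
  have hst : s ≠ t := by rintro rfl; tauto
  have hlr := M.left_lt_right s
  have hv : M.height s v.1 = v.2 := by rcases hs with rfl | rfl <;> rfl
  have hv1 : M.left s ≤ v.1 ∧ v.1 ≤ M.right s := by
    rcases hs with rfl | rfl
    · exact ⟨le_rfl, hlr.le⟩
    · exact ⟨hlr.le, le_rfl⟩
  rw [← hv]
  refine M.height_lt_iff_of_ne fun z hz he => ?_
  have hz1 : M.left s ≤ z ∧ z ≤ M.right s ∧ M.left t ≤ z ∧ z ≤ M.right t ∧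
      (z = v.1 ∨ M.left s < z ∧ z < M.right s) := by
    rcases eq_or_ne z v.1 with rfl | hzv
    · exact ⟨hv1.1, hv1.2, h1, h2, Or.inl rfl⟩
    · rcases Set.mem_uIcc.1 hz with h | h
      · have := lt_of_le_of_ne h.2 hzv
        exact ⟨by linarith, by linarith, by linarith, by linarith,
          Or.inr ⟨by linarith, by linarith⟩⟩
      · have := lt_of_le_of_ne h.1 hzv.symm
        exact ⟨by linarith, by linarith, by linarith, by linarith,
          Or.inr ⟨by linarith, by linarith⟩⟩
  obtain ⟨g1, g2, g3, g4, g5⟩ := hz1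
  obtain ⟨k1, k2⟩ := M.meet s t hst z g1 g2 g3 g4 he
  rcases g5 with rfl | ⟨g5, g6⟩
  · rcases k2 with k | k
    · exact ht (Prod.ext k.symm (by rw [← hv, he, k]; rfl))
    · exact ht' (Prod.ext k.symm (by rw [← hv, he, k]; rfl))
  · rcases k1 with k | k <;> linarith

variable [Fintype S] {W : Type*} [AddCommGroup W] [Module (ZMod 2) W] {ζ : S → W}

/-- Sums the conservation law over all ends satisfying `P`; an arc with both ends there contributes
twice, hence nothing. -/
theorem sum_ends_eq_zero (hζ : ∀ v, ∑ s, M.inc s v • ζ s = 0) (P : ℝ × ℝ → Prop) :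
    ∑ s, (boolInd (P (M.leftEnd s)) + boolInd (P (M.rightEnd s))) • ζ s = 0 := by
  classical
  set Q := (Finset.univ.image M.leftEnd ∪ Finset.univ.image M.rightEnd).filter P with hQ
  have key : ∀ s, boolInd (P (M.leftEnd s)) + boolInd (P (M.rightEnd s)) = ∑ q ∈ Q, M.inc s q := by
    intro s
    simp only [inc, Finset.sum_add_distrib, sum_boolInd_eq]
    congr 1 <;> exact boolInd_congr (by simp [hQ])
  simp_rw [key, Finset.sum_smul]
  rw [Finset.sum_comm]
  exact Finset.sum_eq_zero fun q _ => hζ q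

/-- The sum of the labels of the arcs above the arc `s` over the abscissa `x`. -/
noncomputable def labelAbove (ζ : S → W) (s : S) (x : ℝ) : W :=
  ∑ t, boolInd (M.left t ≤ x ∧ x < M.right t ∧ M.height s x < M.height t x) • ζ t

/-- No arc crosses the interior of `s`, so the set of arcs above `s` changes only at ends lying
above `s` in the strip from `x` to `y`. The total change is zero by `sum_ends_eq_zero`. -/
theorem labelAbove_eq_of_lt (hζ : ∀ v, ∑ s, M.inc s v • ζ s = 0) (s : S) {x y : ℝ}
    (hx : M.left s < x) (hxy : x < y) (hy : y < M.right s) :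
    M.labelAbove ζ s x = M.labelAbove ζ s y := by
  rw [← sub_eq_zero, ZModModule.sub_eq_add, labelAbove, labelAbove, ← Finset.sum_add_distrib,
    ← M.sum_ends_eq_zero hζ fun q => x < q.1 ∧ q.1 ≤ y ∧ M.height s q.1 < q.2]
  refine Finset.sum_congr rfl fun t _ => ?_
  rw [← add_smul]
  congr 1
  have hlr := M.left_lt_right t
  have hdich : (∀ z, x ≤ z → z ≤ y → M.left t ≤ z → z ≤ M.right t →
      M.height s z < M.height t z) ∨ (∀ z, x ≤ z → z ≤ y → M.left t ≤ z → z ≤ M.right t →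
      ¬ M.height s z < M.height t z) := by
    by_cases hst : s = t
    · subst hst; right; intros; exact lt_irrefl _
    by_contra hcon
    push Not at hcon
    obtain ⟨⟨z, h1, h2, h3, h4, h5⟩, ⟨z', h1', h2', h3', h4', h5'⟩⟩ := hcon
    refine absurd (M.height_lt_of_ne (x := z') (y := z) ?_ h5') (not_lt.2 h5)
    intro w hw he
    have hw1 : x ≤ w := by rcases Set.mem_uIcc.1 hw with h | h <;> linarith
    have hw2 : w ≤ y := by rcases Set.mem_uIcc.1 hw with h | h <;> linarith
    have hw3 : M.left t ≤ w := by rcases Set.mem_uIcc.1 hw with h | h <;> linarith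
    have hw4 : w ≤ M.right t := by rcases Set.mem_uIcc.1 hw with h | h <;> linarith
    rcases (M.meet s t hst w (by linarith) (by linarith) hw3 hw4 he).1 with h | h <;> linarith
  simp only [leftEnd, rightEnd, boolInd]
  rcases hdich with hd | hd
  · have e1 : (M.left t ≤ x ∧ x < M.right t ∧ M.height s x < M.height t x) ↔
        (M.left t ≤ x ∧ x < M.right t) :=
      ⟨fun h => ⟨h.1, h.2.1⟩, fun h => ⟨h.1, h.2, hd x le_rfl hxy.le h.1 h.2.le⟩⟩
    have e2 : (M.left t ≤ y ∧ y < M.right t ∧ M.height s y < M.height t y) ↔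
        (M.left t ≤ y ∧ y < M.right t) :=
      ⟨fun h => ⟨h.1, h.2.1⟩, fun h => ⟨h.1, h.2, hd y hxy.le le_rfl h.1 h.2.le⟩⟩
    have e3 : (x < M.left t ∧ M.left t ≤ y ∧ M.height s (M.left t) < M.height t (M.left t)) ↔
        (x < M.left t ∧ M.left t ≤ y) :=
      ⟨fun h => ⟨h.1, h.2.1⟩, fun h => ⟨h.1, h.2, hd _ h.1.le h.2 le_rfl hlr.le⟩⟩
    have e4 : (x < M.right t ∧ M.right t ≤ y ∧ M.height s (M.right t) < M.height t (M.right t)) ↔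
        (x < M.right t ∧ M.right t ≤ y) :=
      ⟨fun h => ⟨h.1, h.2.1⟩, fun h => ⟨h.1, h.2, hd _ h.1.le h.2 hlr.le le_rfl⟩⟩
    simp only [e1, e2, e3, e4]
    -- The half-open convention makes the membership of `t` change exactly when one of its ends
    -- passes through `(x, y]`.
    by_cases c1 : M.left t ≤ x <;> by_cases c2 : M.right t ≤ x <;>
    by_cases c3 : M.left t ≤ y <;> by_cases c4 : M.right t ≤ y <;>
    first
    | (exfalso; linarith)
    | (simp only [← not_le, c1, c2, c3, c4]; decide)
  · have e1 : ¬ (M.left t ≤ x ∧ x < M.right t ∧ M.height s x < M.height t x) :=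
      fun h => hd x le_rfl hxy.le h.1 h.2.1.le h.2.2
    have e2 : ¬ (M.left t ≤ y ∧ y < M.right t ∧ M.height s y < M.height t y) :=
      fun h => hd y hxy.le le_rfl h.1 h.2.1.le h.2.2
    have e3 : ¬ (x < M.left t ∧ M.left t ≤ y ∧ M.height s (M.left t) < M.height t (M.left t)) :=
      fun h => hd _ h.1.le h.2.1 le_rfl hlr.le h.2.2
    have e4 : ¬ (x < M.right t ∧ M.right t ≤ y ∧
        M.height s (M.right t) < M.height t (M.right t)) :=
      fun h => hd _ h.1.le h.2.1 hlr.le le_rfl h.2.2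
    simp only [e1, e2, e3, e4, if_false]

theorem labelAbove_eq (hζ : ∀ v, ∑ s, M.inc s v • ζ s = 0) (s : S) {x y : ℝ}
    (hx : M.left s < x) (hx' : x < M.right s) (hy : M.left s < y) (hy' : y < M.right s) :
    M.labelAbove ζ s x = M.labelAbove ζ s y := by
  rcases lt_trichotomy x y with h | rfl | h
  · exact M.labelAbove_eq_of_lt hζ s hx h hy'
  · rfl
  · exact (M.labelAbove_eq_of_lt hζ s hy h hx').symm

/-- The sum of the labels of the arcs that pass above `v` or start above `v`. -/
noncomputable def labelOver (ζ : S → W) (v : ℝ × ℝ) : W :=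
  ∑ t, boolInd (M.left t ≤ v.1 ∧ v.1 < M.right t ∧ v.2 < M.height t v.1) • ζ t

/-- The two half-open conventions differ by the ends on the open vertical ray above `v`, whose
labels cancel. The first convention suits the arcs leaving `v` to the right, the second those
leaving to the left. -/
theorem labelOver_eq (hζ : ∀ v, ∑ s, M.inc s v • ζ s = 0) (v : ℝ × ℝ) :
    M.labelOver ζ v =
      ∑ t, boolInd (M.left t < v.1 ∧ v.1 ≤ M.right t ∧ v.2 < M.height t v.1) • ζ t := by
  rw [← sub_eq_zero, ZModModule.sub_eq_add, labelOver, ← Finset.sum_add_distrib,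
    ← M.sum_ends_eq_zero hζ fun q => q.1 = v.1 ∧ v.2 < q.2]
  refine Finset.sum_congr rfl fun t _ => ?_
  rw [← add_smul]
  congr 1
  have hlr := M.left_lt_right t
  have e1 : (M.left t = v.1 ∧ v.2 < M.height t (M.left t)) ↔
      (M.left t = v.1 ∧ v.2 < M.height t v.1) := and_congr_right fun h => by rw [h]
  have e2 : (M.right t = v.1 ∧ v.2 < M.height t (M.right t)) ↔
      (M.right t = v.1 ∧ v.2 < M.height t v.1) := and_congr_right fun h => by rw [h]
  simp only [leftEnd, rightEnd, boolInd, e1, e2]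
  simp only [le_antisymm_iff, ← not_le]
  by_cases c1 : M.left t ≤ v.1 <;> by_cases c2 : v.1 ≤ M.left t <;>
  by_cases c3 : M.right t ≤ v.1 <;> by_cases c4 : v.1 ≤ M.right t <;>
  by_cases c5 : M.height t v.1 ≤ v.2 <;>
  first
  | (exfalso; linarith)
  | (simp only [c1, c2, c3, c4, c5]; decide)

/-- With no end strictly right of `v` up to abscissa `x`, the arcs above `s` at `x` are those
passing over `v` together with the part of the fan at `v` that lies above `s`. -/
theorem labelAbove_of_leftEnd_eq {s : S} {v : ℝ × ℝ} {x : ℝ} (hs : M.leftEnd s = v)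
    (hvx : v.1 < x) (hl : ∀ t, v.1 < M.left t → x < M.left t)
    (hr : ∀ t, v.1 < M.right t → x < M.right t) :
    M.labelAbove ζ s x = M.labelOver ζ v +
      ∑ t, boolInd (M.leftEnd t = v ∧ M.height s x < M.height t x) • ζ t := by
  rw [labelAbove, labelOver, ← Finset.sum_add_distrib]
  refine Finset.sum_congr rfl fun t _ => ?_
  rw [← add_smul]
  congr 1
  have hsx : M.left s < x ∧ x < M.right s := by
    subst hs; exact ⟨hvx, hr s (M.left_lt_right s)⟩
  by_cases ht : M.leftEnd t = v
  · rw [boolInd_false (P := M.left t ≤ v.1 ∧ _), zero_add]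
    · refine boolInd_congr ⟨fun h => ⟨ht, h.2.2⟩, fun h => ⟨?_, hr t ?_, h.2⟩⟩
      · subst ht; exact hvx.le
      · subst ht; exact M.left_lt_right t
    · subst ht; exact fun h => lt_irrefl _ h.2.2
  · rw [boolInd_false (P := M.leftEnd t = v ∧ _) (fun h => ht h.1), add_zero]
    refine boolInd_congr ⟨fun h => ?_, fun h => ?_⟩
    · have h1 : M.left t ≤ v.1 := not_lt.1 fun hlt => absurd (hl t hlt) (not_lt.2 h.1)
      have h2 : v.1 < M.right t := hvx.trans h.2.1
      refine ⟨h1, h2, (M.height_lt_iff_of_end (Or.inl hs) hsx.1 hsx.2 ht ?_ h1 h2.le h.1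
        h.2.1.le).1 h.2.2⟩
      rintro rfl; exact lt_irrefl _ h2
    · have h1 := hr t h.2.1
      refine ⟨h.1.trans hvx.le, h1, (M.height_lt_iff_of_end (Or.inl hs) hsx.1 hsx.2 ht ?_ h.1
        h.2.1.le (h.1.trans hvx.le) h1.le).2 h.2.2⟩
      rintro rfl; exact lt_irrefl _ h.2.1

theorem labelAbove_of_rightEnd_eq (hζ : ∀ v, ∑ s, M.inc s v • ζ s = 0) {s : S} {v : ℝ × ℝ} {x : ℝ}
    (hs : M.rightEnd s = v) (hvx : x < v.1) (hl : ∀ t, M.left t < v.1 → M.left t < x)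
    (hr : ∀ t, M.right t < v.1 → M.right t < x) :
    M.labelAbove ζ s x = M.labelOver ζ v +
      ∑ t, boolInd (M.rightEnd t = v ∧ M.height s x < M.height t x) • ζ t := by
  rw [labelAbove, M.labelOver_eq hζ, ← Finset.sum_add_distrib]
  refine Finset.sum_congr rfl fun t _ => ?_
  rw [← add_smul]
  congr 1
  have hsx : M.left s < x ∧ x < M.right s := by
    subst hs; exact ⟨hl s (M.left_lt_right s), hvx⟩
  by_cases ht : M.rightEnd t = v
  · rw [boolInd_false (P := M.left t < v.1 ∧ _), zero_add]
    · refine boolInd_congr ⟨fun h => ⟨ht, h.2.2⟩, fun h => ⟨(hl t ?_).le, ?_, h.2⟩⟩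
      · subst ht; exact M.left_lt_right t
      · subst ht; exact hvx
    · subst ht; exact fun h => lt_irrefl _ h.2.2
  · rw [boolInd_false (P := M.rightEnd t = v ∧ _) (fun h => ht h.1), add_zero]
    refine boolInd_congr ⟨fun h => ?_, fun h => ?_⟩
    · have h1 : v.1 ≤ M.right t := not_lt.1 fun hlt => absurd (hr t hlt) (not_lt.2 h.2.1.le)
      have h2 : M.left t < v.1 := h.1.trans_lt hvx
      refine ⟨h2, h1, (M.height_lt_iff_of_end (Or.inr hs) hsx.1 hsx.2 ?_ ht h2.le h1 h.1
        h.2.1.le).1 h.2.2⟩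
      rintro rfl; exact lt_irrefl _ h2
    · have h1 := hl t h.1
      have h2 := hvx.trans_le h.2.1
      refine ⟨h1.le, h2, (M.height_lt_iff_of_end (Or.inr hs) hsx.1 hsx.2 ?_ ht h.1.le
        h.2.1 h1.le h2.le).2 h.2.2⟩
      rintro rfl; exact lt_irrefl _ h.1

end MonotoneArcs

/-! ### Labels around a point -/

/-- Going down through a fan ordered by `κ`, the region below one arc is the region above the next.
These occurrences cancel in pairs, leaving only the top region `U` and the bottom one. -/
theorem sum_boolInd_telescope {S W : Type*} [AddCommGroup W] (ζ : S → W) (κ : S → ℝ) (U f : W)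
    (R : Finset S) (hκ : Set.InjOn κ R) :
    ∑ s ∈ R, (boolInd (U + ∑ t ∈ R with κ s < κ t, ζ t = f) +
      boolInd (U + ∑ t ∈ R with κ s < κ t, ζ t + ζ s = f)) =
    boolInd (U = f) + boolInd (U + ∑ t ∈ R, ζ t = f) := by
  classical
  induction R using Finset.induction_on_min_value κ with
  | empty => simp [CharTwo.add_self_eq_zero]
  | insert a s ha hmin ih =>
    have hlt : ∀ x ∈ s, κ a < κ x := fun x hx => lt_of_le_of_ne (hmin x hx) fun h =>
      ha (hκ (by simp) (by simp [hx]) h ▸ hx)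
    have h1 : (insert a s).filter (fun t => κ a < κ t) = s := by
      ext t; simp only [Finset.mem_filter, Finset.mem_insert]
      constructor
      · rintro ⟨rfl | h, h'⟩
        · exact absurd h' (lt_irrefl _)
        · exact h
      · exact fun h => ⟨Or.inr h, hlt t h⟩
    have h2 : ∀ x ∈ s, (insert a s).filter (fun t => κ x < κ t) = s.filter fun t => κ x < κ t :=
      fun x hx => by rw [Finset.filter_insert, if_neg (hlt x hx).not_gt]
    rw [Finset.sum_insert ha, h1, Finset.sum_insert ha]
    have h3 : ∑ x ∈ s, (boolInd (U + ∑ t ∈ insert a s with κ x < κ t, ζ t = f) +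
        boolInd (U + ∑ t ∈ insert a s with κ x < κ t, ζ t + ζ x = f)) =
        boolInd (U = f) + boolInd (U + ∑ t ∈ s, ζ t = f) :=
      (Finset.sum_congr rfl fun x hx => by rw [h2 x hx]).trans (ih (hκ.mono (by simp)))
    rw [h3]
    have e : U + ∑ t ∈ s, ζ t + ζ a = U + (ζ a + ∑ t ∈ s, ζ t) := by abel
    rw [e]
    have : ∀ x y z : ZMod 2, x + y + (z + x) = z + y := by decide
    exact this _ _ _

theorem exists_gt_forall_lt {ι : Type*} [Finite ι] (g : ι → ℝ) (a : ℝ) :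
    ∃ x, a < x ∧ ∀ i, a < g i → x < g i := by
  have h : ∀ᶠ x in nhdsWithin a (Set.Ioi a), ∀ i, a < g i → x < g i := by
    rw [Filter.eventually_all]
    intro i
    by_cases hi : a < g i
    · filter_upwards [nhdsWithin_le_nhds (Iio_mem_nhds hi)] with x hx _ using hx
    · exact Filter.Eventually.of_forall fun x h => absurd h hi
  obtain ⟨x, hx, hx'⟩ := (h.and self_mem_nhdsWithin).exists
  exact ⟨x, hx', hx⟩

theorem exists_lt_forall_lt {ι : Type*} [Finite ι] (g : ι → ℝ) (a : ℝ) :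
    ∃ x, x < a ∧ ∀ i, g i < a → g i < x := by
  obtain ⟨x, hx, h⟩ := exists_gt_forall_lt (fun i => - g i) (-a)
  exact ⟨-x, by linarith, fun i hi => by have := h i (by linarith); linarith⟩

theorem sum_boolInd_smul {S W : Type*} [Fintype S] [AddCommGroup W] [Module (ZMod 2) W]
    (P : S → Prop) [DecidablePred P] (g : S → W) :
    ∑ s, boolInd (P s) • g s = ∑ s with P s, g s := by
  rw [Finset.sum_filter]
  refine Finset.sum_congr rfl fun s _ => ?_
  by_cases h : P s <;> simp [boolInd, h]

namespace MonotoneArcs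

variable {S : Type*} (M : MonotoneArcs S) [Fintype S] {W : Type*} [AddCommGroup W]
  [Module (ZMod 2) W] {ζ : S → W}

/-- The label of the region just above an arc. -/
noncomputable def upperLabel (ζ : S → W) (s : S) : W :=
  M.labelAbove ζ s ((M.left s + M.right s) / 2)

theorem upperLabel_eq (hζ : ∀ v, ∑ s, M.inc s v • ζ s = 0) {s : S} {x : ℝ} (hx : M.left s < x)
    (hx' : x < M.right s) : M.upperLabel ζ s = M.labelAbove ζ s x := by
  have := M.left_lt_right s
  exact M.labelAbove_eq hζ s (by linarith) (by linarith) hx hx'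

/-- The right-hand fan at `v` is read off over an abscissa close enough to `v` that no end
intervenes, and telescoped. `sum_rightEnd_eq` does the same on the left; conservation makes the top
and bottom regions of both fans agree. -/
theorem sum_leftEnd_eq (hζ : ∀ v, ∑ s, M.inc s v • ζ s = 0) (f : W) (v : ℝ × ℝ) :
    ∑ s, boolInd (M.leftEnd s = v) •
      (boolInd (M.upperLabel ζ s = f) + boolInd (M.upperLabel ζ s + ζ s = f)) =
    boolInd (M.labelOver ζ v = f) +
      boolInd (M.labelOver ζ v + ∑ s, boolInd (M.leftEnd s = v) • ζ s = f) := by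
  classical
  obtain ⟨x, hx, hlr⟩ := exists_gt_forall_lt (Sum.elim M.left M.right) v.1
  have hl : ∀ t, v.1 < M.left t → x < M.left t := fun t => hlr (Sum.inl t)
  have hr : ∀ t, v.1 < M.right t → x < M.right t := fun t => hlr (Sum.inr t)
  have hin : ∀ s, M.leftEnd s = v → M.left s < x ∧ x < M.right s := by
    rintro s rfl; exact ⟨hx, hr s (M.left_lt_right s)⟩
  rw [sum_boolInd_smul, sum_boolInd_smul, ← sum_boolInd_telescope ζ (fun s => M.height s x)]
  · refine Finset.sum_congr rfl fun s hs => ?_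
    have hs' : M.leftEnd s = v := by simpa using hs
    rw [M.upperLabel_eq hζ (hin s hs').1 (hin s hs').2, M.labelAbove_of_leftEnd_eq hs' hx hl hr,
      sum_boolInd_smul, Finset.filter_filter]
  · intro s hs t ht he
    by_contra hst
    have h1 := hin s (by simpa using hs)
    have h2 := hin t (by simpa using ht)
    rcases (M.meet s t hst x h1.1.le h1.2.le h2.1.le h2.2.le he).1 with h | h <;> linarith

theorem sum_rightEnd_eq (hζ : ∀ v, ∑ s, M.inc s v • ζ s = 0) (f : W) (v : ℝ × ℝ) :
    ∑ s, boolInd (M.rightEnd s = v) •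
      (boolInd (M.upperLabel ζ s = f) + boolInd (M.upperLabel ζ s + ζ s = f)) =
    boolInd (M.labelOver ζ v = f) +
      boolInd (M.labelOver ζ v + ∑ s, boolInd (M.rightEnd s = v) • ζ s = f) := by
  classical
  obtain ⟨x, hx, hlr⟩ := exists_lt_forall_lt (Sum.elim M.left M.right) v.1
  have hl : ∀ t, M.left t < v.1 → M.left t < x := fun t => hlr (Sum.inl t)
  have hr : ∀ t, M.right t < v.1 → M.right t < x := fun t => hlr (Sum.inr t)
  have hin : ∀ s, M.rightEnd s = v → M.left s < x ∧ x < M.right s := by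
    rintro s rfl; exact ⟨hl s (M.left_lt_right s), hx⟩
  rw [sum_boolInd_smul, sum_boolInd_smul, ← sum_boolInd_telescope ζ (fun s => M.height s x)]
  · refine Finset.sum_congr rfl fun s hs => ?_
    have hs' : M.rightEnd s = v := by simpa using hs
    rw [M.upperLabel_eq hζ (hin s hs').1 (hin s hs').2,
      M.labelAbove_of_rightEnd_eq hζ hs' hx hl hr, sum_boolInd_smul, Finset.filter_filter]
  · intro s hs t ht he
    by_contra hst
    have h1 := hin s (by simpa using hs)
    have h2 := hin t (by simpa using ht)
    rcases (M.meet s t hst x h1.1.le h1.2.le h2.1.le h2.2.le he).1 with h | h <;> linarith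

/-- Around every point, each region label occurs an even number of times on the two sides of the
arcs ending there. -/
theorem sum_inc_smul_sides_eq_zero (hζ : ∀ v, ∑ s, M.inc s v • ζ s = 0) (f : W) (v : ℝ × ℝ) :
    ∑ s, M.inc s v •
      (boolInd (M.upperLabel ζ s = f) + boolInd (M.upperLabel ζ s + ζ s = f)) = 0 := by
  have h := hζ v
  simp only [inc, add_smul, Finset.sum_add_distrib] at h
  rw [← ZModModule.sub_eq_add, sub_eq_zero] at h
  simp only [inc, add_smul _ _ (_ + _ : ZMod 2), Finset.sum_add_distrib]
  rw [M.sum_leftEnd_eq hζ, M.sum_rightEnd_eq hζ, h]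
  exact CharTwo.add_self_eq_zero _

end MonotoneArcs

/-! ### From straight segments to monotone arcs -/

namespace MonotoneArcs

/-- Straight line segments none of which is vertical and which meet at most in common end points,
as monotone arcs. -/
noncomputable def ofSegments {S : Type*} (P Q : S → ℝ × ℝ) (hne : ∀ s, (P s).1 ≠ (Q s).1)
    (hmeet : ∀ s t, s ≠ t → ∀ x ∈ segment ℝ (P s) (Q s), x ∈ segment ℝ (P t) (Q t) →
      (x = P s ∨ x = Q s) ∧ (x = P t ∨ x = Q t)) : MonotoneArcs S where
  left s := min (P s).1 (Q s).1
  right s := max (P s).1 (Q s).1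
  height s x := (P s).2 + (x - (P s).1) / ((Q s).1 - (P s).1) * ((Q s).2 - (P s).2)
  left_lt_right s := min_lt_max.2 (hne s)
  continuous_height s := by fun_prop
  meet := by
    have hmem : ∀ s x, min (P s).1 (Q s).1 ≤ x → x ≤ max (P s).1 (Q s).1 →
        (x, (P s).2 + (x - (P s).1) / ((Q s).1 - (P s).1) * ((Q s).2 - (P s).2)) ∈
          segment ℝ (P s) (Q s) := by
      intro s x h1 h2
      rw [segment_eq_image']
      refine ⟨(x - (P s).1) / ((Q s).1 - (P s).1), ?_, ?_⟩
      · rcases lt_or_gt_of_ne (hne s) with h | h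
        · rw [min_eq_left h.le] at h1
          rw [max_eq_right h.le] at h2
          exact ⟨div_nonneg (by linarith) (by linarith), div_le_one_of_le₀ (by linarith) (by linarith)⟩
        · rw [min_eq_right h.le] at h1
          rw [max_eq_left h.le] at h2
          exact ⟨div_nonneg_of_nonpos (by linarith) (by linarith),
            (div_le_one_of_neg (by linarith)).2 (by linarith)⟩
      · have : (Q s).1 - (P s).1 ≠ 0 := sub_ne_zero.2 (hne s).symm
        ext
        · simp only [Prod.fst_add, Prod.smul_fst, Prod.fst_sub, smul_eq_mul]
          field_simp
          ring
        · simp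
    intro s t hst x h1 h2 h3 h4 he
    have hs := hmem s x h1 h2
    have ht := hmem t x h3 h4
    rw [← he] at ht
    obtain ⟨g1, g2⟩ := hmeet s t hst _ hs ht
    have hfin : ∀ r, x = (P r).1 ∨ x = (Q r).1 →
        x = min (P r).1 (Q r).1 ∨ x = max (P r).1 (Q r).1 := by
      intro r h
      rcases le_total (P r).1 (Q r).1 with h' | h'
      · rwa [min_eq_left h', max_eq_right h']
      · rw [min_eq_right h', max_eq_left h']; exact h.symm
    exact ⟨hfin s (g1.imp (congrArg Prod.fst) (congrArg Prod.fst)),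
      hfin t (g2.imp (congrArg Prod.fst) (congrArg Prod.fst))⟩

theorem inc_ofSegments {S : Type*} (P Q : S → ℝ × ℝ) (hne : ∀ s, (P s).1 ≠ (Q s).1)
    (hmeet : ∀ s t, s ≠ t → ∀ x ∈ segment ℝ (P s) (Q s), x ∈ segment ℝ (P t) (Q t) →
      (x = P s ∨ x = Q s) ∧ (x = P t ∨ x = Q t)) (s : S) (v : ℝ × ℝ) :
    (ofSegments P Q hne hmeet).inc s v = boolInd (P s = v) + boolInd (Q s = v) := by
  have hP : ((P s).1, (P s).2 + ((P s).1 - (P s).1) / ((Q s).1 - (P s).1) *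
      ((Q s).2 - (P s).2)) = P s := by ext <;> simp
  have hQ : ((Q s).1, (P s).2 + ((Q s).1 - (P s).1) / ((Q s).1 - (P s).1) *
      ((Q s).2 - (P s).2)) = Q s := by
    have : (Q s).1 - (P s).1 ≠ 0 := sub_ne_zero.2 (hne s).symm
    ext <;> simp [this]
  simp only [inc, leftEnd, rightEnd, ofSegments]
  rcases le_total (P s).1 (Q s).1 with h | h
  · rw [min_eq_left h, max_eq_right h, hP, hQ]
  · rw [min_eq_right h, max_eq_left h, hP, hQ, add_comm]

end MonotoneArcs

/-- A shear of the plane. -/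
def shear (c : ℝ) : (ℝ × ℝ) ≃ₗ[ℝ] (ℝ × ℝ) where
  toFun p := (p.1 + c * p.2, p.2)
  invFun p := (p.1 - c * p.2, p.2)
  map_add' p q := by ext <;> simp; ring
  map_smul' r p := by ext <;> simp; ring
  left_inv p := by ext <;> simp
  right_inv p := by ext <;> simp

/-- Each segment becomes vertical for at most one `c`, so finitely many values are to be avoided.
For a horizontal segment the quotient has denominator zero, and the value it excludes is irrelevant.
-/
theorem exists_shear_fst_ne {S : Type*} [Finite S] (P Q : S → ℝ × ℝ) (h : ∀ s, P s ≠ Q s) :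
    ∃ c, ∀ s, (shear c (P s)).1 ≠ (shear c (Q s)).1 := by
  obtain ⟨c, hc⟩ := (Set.finite_range fun s =>
    -((P s).1 - (Q s).1) / ((P s).2 - (Q s).2)).exists_notMem
  refine ⟨c, fun s he => ?_⟩
  simp only [shear, LinearEquiv.coe_mk, LinearMap.coe_mk, AddHom.coe_mk] at he
  by_cases h2 : (P s).2 = (Q s).2
  · refine h s (Prod.ext ?_ h2)
    rw [h2] at he
    linarith
  · refine hc ⟨s, ?_⟩
    have : (P s).2 - (Q s).2 ≠ 0 := sub_ne_zero.2 h2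
    simp only
    rw [div_eq_iff this]
    linarith

/-- Straight line segments which meet at most in common end points have region labels that are
evenly distributed around every point. -/
theorem exists_labels_of_segments {S : Type*} [Fintype S] (P Q : S → ℝ × ℝ)
    (hne : ∀ s, P s ≠ Q s)
    (hmeet : ∀ s t, s ≠ t → ∀ x ∈ segment ℝ (P s) (Q s), x ∈ segment ℝ (P t) (Q t) →
      (x = P s ∨ x = Q s) ∧ (x = P t ∨ x = Q t))
    {W : Type*} [AddCommGroup W] [Module (ZMod 2) W] (ζ : S → W)
    (hζ : ∀ v, ∑ s, (boolInd (P s = v) + boolInd (Q s = v)) • ζ s = 0) :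
    ∃ A : S → W, ∀ f v, ∑ s, (boolInd (P s = v) + boolInd (Q s = v)) •
      (boolInd (A s = f) + boolInd (A s + ζ s = f)) = 0 := by
  obtain ⟨c, hc⟩ := exists_shear_fst_ne P Q hne
  have hmeet' : ∀ s t, s ≠ t → ∀ x ∈ segment ℝ (shear c (P s)) (shear c (Q s)),
      x ∈ segment ℝ (shear c (P t)) (shear c (Q t)) →
      (x = shear c (P s) ∨ x = shear c (Q s)) ∧ (x = shear c (P t) ∨ x = shear c (Q t)) := by
    intro s t hst x hs ht
    obtain ⟨y, rfl⟩ := (shear c).surjective x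
    have him : ∀ a b, segment ℝ (shear c a) (shear c b) = shear c '' segment ℝ a b := fun a b =>
      (image_segment ℝ (shear c).toLinearMap.toAffineMap a b).symm
    rw [him, (shear c).injective.mem_set_image] at hs ht
    simpa only [(shear c).injective.eq_iff] using hmeet s t hst y hs ht
  set M := MonotoneArcs.ofSegments (fun s => shear c (P s)) (fun s => shear c (Q s)) hc hmeet'
    with hM
  have hinc : ∀ s v, M.inc s (shear c v) = boolInd (P s = v) + boolInd (Q s = v) := by
    intro s v
    rw [hM, MonotoneArcs.inc_ofSegments, (shear c).injective.eq_iff, (shear c).injective.eq_iff]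
  have hζ' : ∀ v, ∑ s, M.inc s v • ζ s = 0 := by
    intro v
    obtain ⟨w, rfl⟩ := (shear c).surjective v
    simp only [hinc, hζ]
  refine ⟨M.upperLabel ζ, fun f v => ?_⟩
  simpa only [hinc] using M.sum_inc_smul_sides_eq_zero hζ' f (shear c v)

/-! ### Edge labels from a plane drawing -/

namespace PlanarMad

namespace PolygonalArc

variable (A : PolygonalArc)

theorem eq_corner_of_eq_end {i : Fin A.n} {x : Plane}
    (hx : x ∈ segment ℝ (A.pt i.castSucc) (A.pt i.succ))
    (h : x = A.pt 0 ∨ x = A.pt (Fin.last A.n)) : x = A.pt i.castSucc ∨ x = A.pt i.succ := by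
  have hpos := A.n_pos
  rcases h with h | h
  · by_cases hi : (⟨0, hpos⟩ : Fin A.n) < i
    · exact Or.inl (A.simple _ _ hi x (by rw [h]; exact left_mem_segment ..) hx).2
    · have : i.castSucc = 0 := by
        ext; simp only [Fin.lt_def] at hi; simp; omega
      exact Or.inl (by rw [h, this])
  · by_cases hi : i < (⟨A.n - 1, by omega⟩ : Fin A.n)
    · refine Or.inr (A.simple _ _ hi x hx ?_).1
      have : (⟨A.n - 1, by omega⟩ : Fin A.n).succ = Fin.last A.n := by ext; simp; omega
      rw [this, h]
      exact right_mem_segment ..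
    · have : i.succ = Fin.last A.n := by
        ext; simp only [Fin.lt_def] at hi; simp; have := i.2; omega
      exact Or.inr (by rw [h, this])

theorem sum_boolInd_corner (v : Plane) :
    ∑ i : Fin A.n, (boolInd (A.pt i.castSucc = v) + boolInd (A.pt i.succ = v)) =
      boolInd (A.pt 0 = v) + boolInd (A.pt (Fin.last A.n) = v) := by
  have h1 := Fin.sum_univ_castSucc fun i => boolInd (A.pt i = v)
  have h2 := Fin.sum_univ_succ fun i => boolInd (A.pt i = v)
  rw [Finset.sum_add_distrib]
  have key : ∀ a b c d : ZMod 2, a + c = d + b → a + b = d + c := by decide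
  exact key _ _ _ _ (h1.symm.trans h2)

end PolygonalArc

namespace PlaneDrawing

variable {V : Type*} {G : SimpleGraph V} (D : PlaneDrawing G)

theorem point_eq_end_iff (e : G.edgeSet) (u : V) :
    (D.point u = (D.arc e).pt 0 ∨ D.point u = (D.arc e).pt (Fin.last _)) ↔
      u ∈ (e : Sym2 V) := by
  have h := D.arc_ends e
  obtain ⟨e, he⟩ := e
  induction e using Sym2.ind with
  | _ a b =>
    rw [PolygonalArc.ends, Sym2.map_mk, Sym2.eq_iff] at h
    rw [Sym2.mem_iff]
    rcases h with ⟨h1, h2⟩ | ⟨h1, h2⟩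
    · rw [h1, h2, D.point_injective.eq_iff, D.point_injective.eq_iff]
    · rw [h1, h2, D.point_injective.eq_iff, D.point_injective.eq_iff, or_comm]

theorem boolInd_end_add (e : G.edgeSet) (u : V) :
    boolInd ((D.arc e).pt 0 = D.point u) + boolInd ((D.arc e).pt (Fin.last _) = D.point u) =
      boolInd (u ∈ (e : Sym2 V)) := by
  rw [← D.point_eq_end_iff e u]
  have hne : (D.arc e).pt 0 ≠ (D.arc e).pt (Fin.last _) := fun h => by
    have := congrArg Fin.val ((D.arc e).pt_injective h)
    have := (D.arc e).n_pos
    simp at *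
    omega
  by_cases h1 : D.point u = (D.arc e).pt 0
  · rw [boolInd_true h1.symm, boolInd_false (h1 ▸ hne.symm), boolInd_true (Or.inl h1), add_zero]
  · rw [boolInd_false (Ne.symm h1), zero_add]
    exact boolInd_congr ⟨fun h => Or.inr h.symm, fun h => (h.resolve_left h1).symm⟩

theorem end_mem_range (e : G.edgeSet) :
    (D.arc e).pt 0 ∈ Set.range D.point ∧ (D.arc e).pt (Fin.last _) ∈ Set.range D.point := by
  have h := D.arc_ends e
  obtain ⟨e, he⟩ := e
  induction e using Sym2.ind with
  | _ a b =>
    rw [PolygonalArc.ends, Sym2.map_mk, Sym2.eq_iff] at h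
    rcases h with ⟨h1, h2⟩ | ⟨h1, h2⟩ <;> rw [h1, h2] <;> exact ⟨⟨_, rfl⟩, ⟨_, rfl⟩⟩

theorem mem_carrier {A : PolygonalArc} {x : Plane} (i : Fin A.n)
    (h : x ∈ segment ℝ (A.pt i.castSucc) (A.pt i.succ)) : x ∈ A.carrier :=
  Set.mem_iUnion.2 ⟨i, h⟩

theorem segments_meet (s t : Σ e : G.edgeSet, Fin (D.arc e).n) (hst : s ≠ t) (x : Plane)
    (hs : x ∈ segment ℝ ((D.arc s.1).pt s.2.castSucc) ((D.arc s.1).pt s.2.succ))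
    (ht : x ∈ segment ℝ ((D.arc t.1).pt t.2.castSucc) ((D.arc t.1).pt t.2.succ)) :
    (x = (D.arc s.1).pt s.2.castSucc ∨ x = (D.arc s.1).pt s.2.succ) ∧
      (x = (D.arc t.1).pt t.2.castSucc ∨ x = (D.arc t.1).pt t.2.succ) := by
  obtain ⟨e, i⟩ := s
  obtain ⟨f, j⟩ := t
  by_cases hef : e = f
  · subst hef
    rcases lt_trichotomy i j with h | rfl | h
    · have := (D.arc e).simple i j h x hs ht
      exact ⟨Or.inr this.1, Or.inl this.2⟩
    · exact absurd rfl hst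
    · have := (D.arc e).simple j i h x ht hs
      exact ⟨Or.inl this.2, Or.inr this.1⟩
  · obtain ⟨v, hve, hvf, rfl⟩ := D.arc_inter e f hef x (mem_carrier i hs) (mem_carrier j ht)
    exact ⟨PolygonalArc.eq_corner_of_eq_end _ hs ((D.point_eq_end_iff e v).2 hve),
      PolygonalArc.eq_corner_of_eq_end _ ht ((D.point_eq_end_iff f v).2 hvf)⟩

/-- The number (modulo two) of ends of a segment of the drawing at the point `v`. -/
noncomputable def segInc (s : Σ e : G.edgeSet, Fin (D.arc e).n) (v : Plane) : ZMod 2 :=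
  boolInd ((D.arc s.1).pt s.2.castSucc = v) + boolInd ((D.arc s.1).pt s.2.succ = v)

/-- An inner corner of an arc lies on no other arc, since arcs meet only at vertices, and
injectivity of `pt` leaves just two segments of its own arc ending there. -/
theorem segInc_eq_zero {e : G.edgeSet} {i : Fin (D.arc e).n} (hi : i.1 + 1 < (D.arc e).n)
    (s : Σ e : G.edgeSet, Fin (D.arc e).n) (h1 : s ≠ ⟨e, i⟩) (h2 : s ≠ ⟨e, ⟨i.1 + 1, hi⟩⟩) :
    D.segInc s ((D.arc e).pt i.succ) = 0 := by
  obtain ⟨f, j⟩ := s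
  have key : (D.arc f).pt j.castSucc ≠ (D.arc e).pt i.succ ∧
      (D.arc f).pt j.succ ≠ (D.arc e).pt i.succ := by
    by_cases hef : f = e
    · subst hef
      refine ⟨fun h => h2 ?_, fun h => h1 ?_⟩
      · have := congrArg Fin.val ((D.arc f).pt_injective h)
        congr 1
        ext
        simpa using this
      · have := congrArg Fin.val ((D.arc f).pt_injective h)
        congr 1
        ext
        simpa using this
    · have main : (D.arc e).pt i.succ ∉ (D.arc f).carrier := by
        intro hf
        obtain ⟨v, -, hv, hp⟩ := D.arc_inter f e hef _ hf (mem_carrier i (right_mem_segment ..))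
        rcases (D.point_eq_end_iff e v).2 hv with h | h
        · have := congrArg Fin.val ((D.arc e).pt_injective (hp.trans h))
          simp at this
        · have := congrArg Fin.val ((D.arc e).pt_injective (hp.trans h))
          simp at this
          omega
      refine ⟨fun h => main (h ▸ ?_), fun h => main (h ▸ ?_)⟩
      · exact mem_carrier j (left_mem_segment ..)
      · exact mem_carrier j (right_mem_segment ..)
  rw [segInc, boolInd_false key.1, boolInd_false key.2, add_zero]

theorem segInc_self {e : G.edgeSet} {i : Fin (D.arc e).n} :
    D.segInc ⟨e, i⟩ ((D.arc e).pt i.succ) = 1 := by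
  rw [segInc, boolInd_true rfl, boolInd_false, zero_add]
  intro h
  have := congrArg Fin.val ((D.arc e).pt_injective h)
  simp at this

theorem segInc_next {e : G.edgeSet} {i : Fin (D.arc e).n} (hi : i.1 + 1 < (D.arc e).n) :
    D.segInc ⟨e, ⟨i.1 + 1, hi⟩⟩ ((D.arc e).pt i.succ) = 1 := by
  rw [segInc, boolInd_true, boolInd_false, add_zero]
  · intro h
    have := congrArg Fin.val ((D.arc e).pt_injective h)
    simp at this
  · rfl

variable [Fintype G.edgeSet]

theorem sum_segInc_smul {W : Type*} [AddCommGroup W] [Module (ZMod 2) W] (X : G.edgeSet → W)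
    (v : Plane) : ∑ s, D.segInc s v • X s.1 =
      ∑ e, (boolInd ((D.arc e).pt 0 = v) + boolInd ((D.arc e).pt (Fin.last _) = v)) • X e := by
  rw [Fintype.sum_sigma]
  refine Finset.sum_congr rfl fun e _ => ?_
  rw [← PolygonalArc.sum_boolInd_corner, Finset.sum_smul]
  rfl

/-- The edges of a plane graph have labels for the regions on their two sides, which are evenly
distributed around every vertex. -/
theorem exists_labels (D : PlaneDrawing G) {W : Type*} [AddCommGroup W] [Module (ZMod 2) W] (ζ : G.edgeSet → W)
    (hζ : ∀ u, ∑ e : G.edgeSet, boolInd (u ∈ (e : Sym2 V)) • ζ e = 0) :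
    ∃ A : G.edgeSet → W, ∀ f u, ∑ e : G.edgeSet, boolInd (u ∈ (e : Sym2 V)) •
      (boolInd (A e = f) + boolInd (A e + ζ e = f)) = 0 := by
  have h0 : ∀ v, ∑ s : Σ e : G.edgeSet, Fin (D.arc e).n, D.segInc s v • ζ s.1 = 0 := by
    intro v
    rw [sum_segInc_smul]
    by_cases hv : v ∈ Set.range D.point
    · obtain ⟨u, rfl⟩ := hv
      simp only [boolInd_end_add, hζ]
    · refine Finset.sum_eq_zero fun e _ => ?_
      rw [boolInd_false fun h : _ = v => hv (h ▸ (D.end_mem_range e).1),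
        boolInd_false fun h : _ = v => hv (h ▸ (D.end_mem_range e).2), add_zero, zero_smul]
  obtain ⟨A, hA⟩ := exists_labels_of_segments
    (fun s : Σ e : G.edgeSet, Fin (D.arc e).n => (D.arc s.1).pt s.2.castSucc)
    (fun s => (D.arc s.1).pt s.2.succ)
    (fun s h => by
      have := congrArg Fin.val ((D.arc s.1).pt_injective h)
      simp at this)
    D.segments_meet (fun s => ζ s.1) h0
  change ∀ f v, ∑ s : Σ e : G.edgeSet, Fin (D.arc e).n, D.segInc s v • (boolInd (A s = f) + boolInd (A s + ζ s.1 = f)) = 0 at hA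
  -- At an inner corner only two segments end, so evenness forces their side labels to agree as
  -- pairs modulo two. The label `A` itself need not be constant along the arc: its upper and lower
  -- sides swap where the arc turns back.
  have hstep : ∀ f (e : G.edgeSet) (k : ℕ) (hk : k < (D.arc e).n),
      boolInd (A ⟨e, ⟨k, hk⟩⟩ = f) + boolInd (A ⟨e, ⟨k, hk⟩⟩ + ζ e = f) =
      boolInd (A ⟨e, ⟨0, (D.arc e).n_pos⟩⟩ = f) +
        boolInd (A ⟨e, ⟨0, (D.arc e).n_pos⟩⟩ + ζ e = f) := by
    intro f e k
    induction k with
    | zero => intro _; rfl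
    | succ k ih =>
      intro hk
      rw [← ih (by omega)]
      have := hA f ((D.arc e).pt (⟨k, by omega⟩ : Fin (D.arc e).n).succ)
      rw [Fintype.sum_eq_add (⟨e, ⟨k, by omega⟩⟩ : Σ e : G.edgeSet, Fin (D.arc e).n)
        ⟨e, ⟨k + 1, hk⟩⟩ (by simp) fun s hs => by rw [D.segInc_eq_zero hk s hs.1 hs.2, zero_smul],
        segInc_self, D.segInc_next (i := ⟨k, by omega⟩) hk, one_smul, one_smul] at this
      exact (CharTwo.add_eq_zero.1 this).symm
  refine ⟨fun e => A ⟨e, ⟨0, (D.arc e).n_pos⟩⟩, fun f u => ?_⟩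
  have h := hA f (D.point u)
  rw [Finset.sum_congr rfl fun s _ => by rw [hstep f s.1 s.2.1 s.2.2]] at h
  rw [D.sum_segInc_smul fun e => boolInd (A ⟨e, ⟨0, (D.arc e).n_pos⟩⟩ = f) +
        boolInd (A ⟨e, ⟨0, (D.arc e).n_pos⟩⟩ + ζ e = f)] at h
  simpa only [boolInd_end_add] using h

end PlaneDrawing

end PlanarMad

/-! ### The cut space and the classes of edges -/

namespace PlanarMad

variable {V : Type*} {G : SimpleGraph V}

/-- The edges with exactly one end in `S`. -/
def cutEdges (G : SimpleGraph V) (S : Set V) : Set (Sym2 V) :=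
  {e | ∃ a ∈ S, ∃ b ∉ S, G.Adj a b ∧ e = s(a, b)}

/-- The (modulo two) indicator of the edges at a vertex. -/
noncomputable def star (G : SimpleGraph V) (u : V) : G.edgeSet → ZMod 2 :=
  fun e => boolInd (u ∈ (e : Sym2 V))

/-- The cut space of a graph over the field with two elements. -/
noncomputable def cutSpace (G : SimpleGraph V) : Submodule (ZMod 2) (G.edgeSet → ZMod 2) :=
  Submodule.span (ZMod 2) (Set.range (star G))

open Classical in
/-- The class of an edge modulo the cut space. -/
noncomputable def edgeClass (G : SimpleGraph V) (e : G.edgeSet) :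
    (G.edgeSet → ZMod 2) ⧸ cutSpace G :=
  (cutSpace G).mkQ (Pi.single e 1)

theorem sum_star_smul_edgeClass [Fintype G.edgeSet] (u : V) :
    ∑ e : G.edgeSet, boolInd (u ∈ (e : Sym2 V)) • edgeClass G e = 0 := by
  classical
  simp only [edgeClass, ← map_smul, ← map_sum]
  rw [Submodule.mkQ_apply, Submodule.Quotient.mk_eq_zero]
  refine (Submodule.subset_span ⟨u, ?_⟩ : _ ∈ cutSpace G)
  ext e
  simp [star, Finset.sum_apply, Pi.single_apply]

section

variable [Fintype V]

theorem sum_smul_star_apply (c : V → ZMod 2) {a b : V} (h : s(a, b) ∈ G.edgeSet) :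
    (∑ u, c u • star G u) ⟨s(a, b), h⟩ = c a + c b := by
  classical
  have hab : a ≠ b := SimpleGraph.Adj.ne h
  rw [Finset.sum_apply, Fintype.sum_eq_add a b hab]
  · simp [star, boolInd]
  · rintro x ⟨h1, h2⟩
    simp [star, boolInd, h1, h2]

/-- Every edge has two ends, so the stars sum to zero and one of them is redundant as a generator.
-/
theorem finrank_cutSpace_lt [Nonempty V] [Finite G.edgeSet] :
    Module.finrank (ZMod 2) (cutSpace G) + 1 ≤ Fintype.card V := by
  classical
  obtain ⟨u⟩ := ‹Nonempty V›
  have hsum : ∑ v, star G v = 0 := by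
    ext ⟨e, he⟩
    induction e using Sym2.ind with
    | _ a b =>
      have := sum_smul_star_apply (fun _ => 1) he
      simp only [one_smul] at this
      rw [this]
      exact CharTwo.add_self_eq_zero _
  have hspan : cutSpace G =
      Submodule.span (ZMod 2) (((Finset.univ.erase u).image (star G) : Finset _) : Set _) := by
    refine le_antisymm (Submodule.span_le.2 ?_) (Submodule.span_mono ?_)
    · rintro _ ⟨v, rfl⟩
      have hother : ∀ w, w ≠ u → star G w ∈ Submodule.span (ZMod 2)
          (((Finset.univ.erase u).image (star G) : Finset _) : Set (G.edgeSet → ZMod 2)) :=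
        fun w hw => Submodule.subset_span (by
          rw [Finset.mem_coe]
          exact Finset.mem_image_of_mem _ (Finset.mem_erase.2 ⟨hw, Finset.mem_univ _⟩))
      by_cases hv : v = u
      · subst hv
        rw [← Finset.add_sum_erase _ _ (Finset.mem_univ v), ← eq_neg_iff_add_eq_zero] at hsum
        rw [hsum]
        exact Submodule.neg_mem _ (Submodule.sum_mem _ fun w hw =>
          hother w (Finset.mem_erase.1 hw).1)
      · exact hother v hv
    · intro x hx
      obtain ⟨w, -, rfl⟩ := Finset.mem_image.1 hx
      exact ⟨w, rfl⟩
  have h1 := finrank_span_finset_le_card (R := ZMod 2) ((Finset.univ.erase u).image (star G))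
  have h2 : ((Finset.univ.erase u).image (star G)).card ≤ (Finset.univ.erase u).card :=
    Finset.card_image_le
  rw [Finset.card_erase_of_mem (Finset.mem_univ u), Finset.card_univ] at h2
  have h3 : 0 < Fintype.card V := Fintype.card_pos_iff.2 ⟨u⟩
  rw [hspan]
  change Module.finrank (ZMod 2) (Submodule.span _ _) ≤ _ at h1
  omega

/-- A nonzero element of the cut space whose support has at most two edges gives a small cut. -/
theorem exists_cutEdges_subset {x : G.edgeSet → ZMod 2} (hx : x ∈ cutSpace G) (hx0 : x ≠ 0) :
    ∃ S : Set V, S.Nonempty ∧ Sᶜ.Nonempty ∧ cutEdges G S ⊆ (↑) '' {e | x e ≠ 0} := by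
  obtain ⟨c, rfl⟩ := (Submodule.mem_span_range_iff_exists_fun _).1 hx
  have h01 : ∀ y z : ZMod 2, y + z ≠ 0 → (y = 1 ∧ z ≠ 1) ∨ (z = 1 ∧ y ≠ 1) := by decide
  -- An edge is in the support of a combination of stars exactly when the coefficients at its ends
  -- differ.
  refine ⟨{u | c u = 1}, ?_, ?_, ?_⟩
  · obtain ⟨⟨e, he⟩, h⟩ := Function.ne_iff.1 hx0
    induction e using Sym2.ind with
    | _ a b =>
      rw [sum_smul_star_apply, Pi.zero_apply] at h
      rcases h01 _ _ h with h | h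
      exacts [⟨a, h.1⟩, ⟨b, h.1⟩]
  · obtain ⟨⟨e, he⟩, h⟩ := Function.ne_iff.1 hx0
    induction e using Sym2.ind with
    | _ a b =>
      rw [sum_smul_star_apply, Pi.zero_apply] at h
      rcases h01 _ _ h with h | h
      exacts [⟨b, h.2⟩, ⟨a, h.2⟩]
  · rintro _ ⟨a, ha, b, hb, hab, rfl⟩
    refine ⟨⟨s(a, b), hab⟩, ?_, rfl⟩
    have h10 : ∀ y z : ZMod 2, y = 1 → z ≠ 1 → y + z ≠ 0 := by decide
    exact fun h => h10 _ _ ha hb ((sum_smul_star_apply c hab).symm.trans h)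

/-- A vanishing class would put the indicator of `e` in the cut space, giving a cut contained in
`{e}`. -/
theorem edgeClass_ne_zero (hcut : ∀ S : Set V, S.Nonempty → Sᶜ.Nonempty → 3 ≤ (cutEdges G S).ncard)
    (e : G.edgeSet) : edgeClass G e ≠ 0 := by
  classical
  intro h
  rw [edgeClass, Submodule.mkQ_apply, Submodule.Quotient.mk_eq_zero] at h
  obtain ⟨S, h1, h2, h3⟩ := exists_cutEdges_subset h (by simp)
  have h4 : cutEdges G S ⊆ {(e : Sym2 V)} := by
    refine h3.trans ?_
    rintro _ ⟨x, hx, rfl⟩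
    by_contra hne
    exact hx (by simp [show x ≠ e from fun h => hne (by simp [h])])
  have h5 := Set.ncard_le_ncard h4
  have h6 := hcut S h1 h2
  rw [Set.ncard_singleton] at h5
  omega

/-- Equal classes of two edges would give a nontrivial cut contained in these two edges; this is
where cuts of size two must be excluded. -/
theorem edgeClass_injective
    (hcut : ∀ S : Set V, S.Nonempty → Sᶜ.Nonempty → 3 ≤ (cutEdges G S).ncard) :
    Function.Injective (edgeClass G) := by
  classical
  intro e f h
  by_contra hef
  rw [edgeClass, edgeClass, ← sub_eq_zero, ← map_sub, Submodule.mkQ_apply,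
    Submodule.Quotient.mk_eq_zero] at h
  obtain ⟨S, h1, h2, h3⟩ := exists_cutEdges_subset h (fun h0 => by
    have := congrFun h0 e
    simp [hef] at this)
  have h4 : cutEdges G S ⊆ {(e : Sym2 V), (f : Sym2 V)} := by
    refine h3.trans ?_
    rintro _ ⟨x, hx, rfl⟩
    by_contra hne
    simp only [Set.mem_insert_iff, Set.mem_singleton_iff, not_or] at hne
    exact hx (by simp [show x ≠ e from fun h => hne.1 (by simp [h]),
      show x ≠ f from fun h => hne.2 (by simp [h])])
  have h5 := Set.ncard_le_ncard h4
  have h6 := hcut S h1 h2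
  have h7 := Set.ncard_insert_le (e : Sym2 V) {(f : Sym2 V)}
  rw [Set.ncard_singleton] at h7
  omega

end

theorem span_range_edgeClass [Finite G.edgeSet] :
    Submodule.span (ZMod 2) (Set.range (edgeClass G)) = ⊤ := by
  classical
  have h : Set.range (edgeClass G) = (cutSpace G).mkQ '' Set.range fun e => Pi.single e 1 := by
    rw [← Set.range_comp]
    rfl
  rw [h, Submodule.span_image]
  have h2 : Submodule.span (ZMod 2) (Set.range fun e : G.edgeSet => Pi.single e (1 : ZMod 2)) = ⊤ := by
    rw [← (Pi.basisFun (ZMod 2) G.edgeSet).span_eq]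
    congr 2
    ext e
    simp
  rw [h2, Submodule.map_top, Submodule.range_mkQ]

/-- With one label taken as origin, the other `Φ.card - 1` labels span all differences, in
particular every `ζ e`. -/
theorem finrank_lt_card_of_span_sub {W ι : Type*} [AddCommGroup W] [Module (ZMod 2) W] [Nonempty ι]
    (A ζ : ι → W) (hζ : Submodule.span (ZMod 2) (Set.range ζ) = ⊤) (Φ : Finset W)
    (hA : ∀ e, A e ∈ Φ) (hB : ∀ e, A e + ζ e ∈ Φ) : Module.finrank (ZMod 2) W + 1 ≤ Φ.card := by
  classical
  obtain ⟨e₀⟩ := ‹Nonempty ι›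
  set Ψ := (Φ.erase (A e₀)).image fun f => f - A e₀ with hΨ
  have hmem : ∀ f ∈ Φ, f - A e₀ ∈ Submodule.span (ZMod 2) (Ψ : Set W) := by
    intro f hf
    by_cases h : f = A e₀
    · rw [h, sub_self]; exact Submodule.zero_mem _
    · refine Submodule.subset_span ?_
      rw [Finset.mem_coe]
      exact Finset.mem_image_of_mem _ (Finset.mem_erase.2 ⟨h, hf⟩)
  have htop : Submodule.span (ZMod 2) (Ψ : Set W) = ⊤ := by
    rw [eq_top_iff, ← hζ, Submodule.span_le]
    rintro _ ⟨e, rfl⟩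
    have := Submodule.sub_mem _ (hmem _ (hB e)) (hmem _ (hA e))
    rwa [sub_sub_sub_cancel_right, add_sub_cancel_left] at this
  have h1 : Module.finrank (ZMod 2) (Submodule.span (ZMod 2) (Ψ : Set W)) ≤ Ψ.card :=
    finrank_span_finset_le_card Ψ
  rw [htop, finrank_top] at h1
  have h2 : Ψ.card ≤ (Φ.erase (A e₀)).card := Finset.card_image_le
  have h3 := Finset.card_erase_add_one (hA e₀)
  omega

/-! ### Faces as labels -/

open Classical in
/-- A plane graph without cuts of less than three edges has a system of face boundaries: at least
`|E| - |V| + 2` nonempty even edge sets, two of which have at most one common edge, such that every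
edge lies in exactly two of them. -/
theorem PlaneDrawing.exists_faces {V : Type u} {G : SimpleGraph V} [Fintype V] [Nonempty V] (D : PlaneDrawing G)
    (hE : G.edgeSet.Nonempty)
    (hcut : ∀ S : Set V, S.Nonempty → Sᶜ.Nonempty → 3 ≤ (cutEdges G S).ncard) :
    ∃ (F : Type u) (_ : Fintype F) (bd : F → Finset (Sym2 V)),
      G.edgeSet.ncard + 2 ≤ Fintype.card F + Fintype.card V ∧
      (∀ f, ∀ e ∈ bd f, e ∈ G.edgeSet) ∧
      (∀ f, (bd f).Nonempty) ∧
      (∀ e ∈ G.edgeSet, (Finset.univ.filter fun f => e ∈ bd f).card = 2) ∧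
      (∀ f g, f ≠ g → ∀ e e', e ∈ bd f → e ∈ bd g → e' ∈ bd f → e' ∈ bd g → e = e') ∧
      ∀ f u, Even ((bd f).filter fun e => u ∈ e).card := by
  obtain ⟨A, hA⟩ := D.exists_labels (edgeClass G) sum_star_smul_edgeClass
  set ζ := edgeClass G with hζ
  have hne : ∀ e, A e ≠ A e + ζ e := fun e h => edgeClass_ne_zero hcut e (by simpa using h)
  set Φ := Finset.univ.image A ∪ Finset.univ.image (fun e => A e + ζ e) with hΦ
  have hAΦ : ∀ e, A e ∈ Φ := fun e =>
    Finset.mem_union_left _ (Finset.mem_image_of_mem _ (Finset.mem_univ e))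
  have hBΦ : ∀ e, A e + ζ e ∈ Φ := fun e =>
    Finset.mem_union_right _ (Finset.mem_image_of_mem (fun e => A e + ζ e) (Finset.mem_univ e))
  set bd : Φ → Finset (Sym2 V) := fun f =>
    (Finset.univ.filter fun e : G.edgeSet => A e = f ∨ A e + ζ e = f).map
      (Function.Embedding.subtype _) with hbd
  have hmem : ∀ f (e : G.edgeSet), (e : Sym2 V) ∈ bd f ↔ A e = f ∨ A e + ζ e = f := by
    rintro f ⟨e, he⟩
    simp only [hbd, Finset.mem_map, Finset.mem_filter, Finset.mem_univ, true_and,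
      Function.Embedding.subtype_apply]
    constructor
    · rintro ⟨a, ha, rfl⟩; exact ha
    · exact fun h => ⟨_, h, rfl⟩
  have hsub : ∀ f, ∀ e ∈ bd f, e ∈ G.edgeSet := by
    intro f e he
    obtain ⟨a, -, rfl⟩ := Finset.mem_map.1 he
    exact a.2
  refine ⟨Φ, inferInstance, bd, ?_, hsub, ?_, ?_, ?_, ?_⟩
  · have : Nonempty G.edgeSet := hE.to_subtype
    -- Euler's inequality: the number of labels is at least `dim W + 1`, where `dim W` is |E| minus
    -- the dimension of the cut space, and the latter is at most |V| - 1.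
    have h1 := finrank_lt_card_of_span_sub A ζ span_range_edgeClass Φ hAΦ hBΦ
    have h2 := (cutSpace G).finrank_quotient_add_finrank
    have h3 := finrank_cutSpace_lt (G := G)
    rw [Module.finrank_fintype_fun_eq_card] at h2
    have h4 : G.edgeSet.ncard = Fintype.card G.edgeSet := by
      rw [← Nat.card_coe_set_eq, Nat.card_eq_fintype_card]
    rw [Fintype.card_coe]
    omega
  · rintro ⟨f, hf⟩
    rcases Finset.mem_union.1 hf with h | h
    · obtain ⟨e, -, rfl⟩ := Finset.mem_image.1 h
      exact ⟨e, (hmem _ e).2 (Or.inl rfl)⟩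
    · obtain ⟨e, -, rfl⟩ := Finset.mem_image.1 h
      exact ⟨e, (hmem _ e).2 (Or.inr rfl)⟩
  · intro e he
    have : (Finset.univ.filter fun f => e ∈ bd f) =
        {⟨A ⟨e, he⟩, hAΦ _⟩, ⟨A ⟨e, he⟩ + ζ ⟨e, he⟩, hBΦ _⟩} := by
      ext f
      rw [Finset.mem_filter, hmem f ⟨e, he⟩]
      simp only [Finset.mem_univ, true_and, Finset.mem_insert, Finset.mem_singleton,
        Subtype.ext_iff]
      exact or_congr eq_comm eq_comm
    rw [this, Finset.card_pair]
    exact fun h => hne _ (congrArg Subtype.val h)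
  · intro f g hfg e e' h1 h2 h3 h4
    have hfg' : (f : _ ⧸ cutSpace G) ≠ g := fun h => hfg (Subtype.ext h)
    -- An edge shared by `f` and `g` has these two labels on its sides, so its class is their
    -- difference and determines the edge.
    have key : ∀ x : G.edgeSet, (x : Sym2 V) ∈ bd f → (x : Sym2 V) ∈ bd g →
        ζ x = (f : _ ⧸ cutSpace G) - g := by
      intro x hf hg
      have h0 : ζ x + ζ x = 0 := ZModModule.add_self _
      rcases (hmem f x).1 hf with hf | hf <;> rcases (hmem g x).1 hg with hg | hg
      · exact absurd (hf.symm.trans hg) hfg'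
      · rw [← hf, ← hg, ← sub_eq_zero, ← h0]; abel
      · rw [← hf, ← hg]; abel
      · exact absurd (hf.symm.trans hg) hfg'
    have := edgeClass_injective hcut ((key ⟨e, hsub _ _ h1⟩ h1 h2).trans
      (key ⟨e', hsub _ _ h3⟩ h3 h4).symm)
    exact congrArg Subtype.val this
  · intro f u
    rw [← ZMod.natCast_eq_zero_iff_even, ← hA f u]
    rw [hbd, Finset.filter_map, Finset.card_map, Finset.filter_filter, Finset.natCast_card_filter]
    refine Finset.sum_congr rfl fun e _ => ?_
    have hor : boolInd (A e = f) + boolInd (A e + ζ e = f) =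
        boolInd (A e = f ∨ A e + ζ e = f) := by
      by_cases h1 : A e = f
      · rw [boolInd_true h1, boolInd_false (fun h => hne e (h1.trans h.symm)),
          boolInd_true (Or.inl h1), add_zero]
      · rw [boolInd_false h1, zero_add]
        exact boolInd_congr ⟨Or.inr, fun h => h.resolve_left h1⟩
    rw [hor]
    by_cases h1 : A e = f ∨ A e + ζ e = f <;> by_cases h2 : u ∈ (e : Sym2 V) <;>
      simp [boolInd, h1, h2]

end PlanarMad

/-! ### Short even edge sets and discharging -/

namespace PlanarMad

open Classical in
theorem exists_other_edge {V : Type*} {K : Finset (Sym2 V)}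
    (hK : ∀ u, Even (K.filter fun e => u ∈ e).card) {a b : V} (h : s(a, b) ∈ K) :
    ∃ c, c ≠ b ∧ s(a, c) ∈ K := by
  have h1 : s(a, b) ∈ K.filter fun e => a ∈ e := Finset.mem_filter.2 ⟨h, Sym2.mem_mk_left a b⟩
  have h2 : 1 < (K.filter fun e => a ∈ e).card := by
    have h3 := Finset.card_pos.2 ⟨_, h1⟩
    obtain ⟨k, hk⟩ := hK a
    omega
  obtain ⟨e, he, hne⟩ := Finset.exists_mem_ne h2 s(a, b)
  obtain ⟨heK, hae⟩ := Finset.mem_filter.1 he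
  obtain ⟨c, rfl⟩ := Sym2.mem_iff_exists.1 hae
  exact ⟨c, fun h => hne (by rw [h]), heK⟩

variable {V : Type*} {G : SimpleGraph V}

theorem isTriangle_of_adj {a b c : V} (hab : G.Adj a b) (hbc : G.Adj b c) (hca : G.Adj c a) :
    ∃ T : G.Subgraph, IsTriangle T ∧ T.edgeSet = {s(a, b), s(b, c), s(c, a)} := by
  refine ⟨(SimpleGraph.Walk.cons hab (.cons hbc (.cons hca .nil))).toSubgraph,
    ⟨a, _, ?_, rfl, rfl⟩, ?_⟩
  · have h1 := hab.ne
    have h2 := hbc.ne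
    have h3 := hca.ne
    simp [SimpleGraph.Walk.isCycle_def, h1, h2, h3, h1.symm, h3.symm]
  · ext e
    simp
    tauto

theorem isCycleOfLength_four_of_adj {a b c d : V} (hab : G.Adj a b) (hbc : G.Adj b c)
    (hcd : G.Adj c d) (hda : G.Adj d a) (hac : a ≠ c) (hbd : b ≠ d) :
    ∃ C : G.Subgraph, IsCycleOfLength 4 C ∧
      C.edgeSet = {s(a, b), s(b, c), s(c, d), s(d, a)} := by
  refine ⟨(SimpleGraph.Walk.cons hab (.cons hbc (.cons hcd (.cons hda .nil)))).toSubgraph,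
    ⟨a, _, ?_, rfl, rfl⟩, ?_⟩
  · have h1 := hab.ne
    have h2 := hbc.ne
    have h3 := hcd.ne
    have h4 := hda.ne
    simp [SimpleGraph.Walk.isCycle_def, h1, h2, h3, h4, h1.symm, h4.symm,
      hac, hbd, hac.symm]
  · ext e
    simp
    tauto

open Classical in
/-- A nonempty even edge set has at least three edges; if there are three, they form a triangle, if
there are four, they form a cycle. -/
theorem three_le_card_of_even {K : Finset (Sym2 V)} (hKG : ∀ e ∈ K, e ∈ G.edgeSet)
    (hne : K.Nonempty) (hK : ∀ u, Even (K.filter fun e => u ∈ e).card) :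
    3 ≤ K.card ∧ (K.card = 3 → ∃ T : G.Subgraph, IsTriangle T ∧ T.edgeSet = K) ∧
      (K.card = 4 → ∃ C : G.Subgraph, IsCycleOfLength 4 C ∧ C.edgeSet = K) := by
  obtain ⟨e, he⟩ := hne
  induction e using Sym2.ind with
  | _ a b =>
  have adj : ∀ {x y : V}, s(x, y) ∈ K → G.Adj x y := fun h => hKG _ h
  obtain ⟨c, hcb, hac⟩ := exists_other_edge hK he
  obtain ⟨d, hda, hbd⟩ := exists_other_edge hK (Sym2.eq_swap ▸ he : s(b, a) ∈ K)
  have nab := (adj he).ne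
  have nac := (adj hac).ne
  have nbd := (adj hbd).ne
  have hsub : ({s(a, b), s(a, c), s(b, d)} : Finset (Sym2 V)) ⊆ K := by
    simp [Finset.insert_subset_iff, he, hac, hbd]
  have hcard : ({s(a, b), s(a, c), s(b, d)} : Finset (Sym2 V)).card = 3 :=
    Finset.card_eq_three.2 ⟨_, _, _, by simp; grind, by simp; grind, by simp; grind, rfl⟩
  have h3 : 3 ≤ K.card := hcard ▸ Finset.card_le_card hsub
  by_cases hcd : c = d
  · subst hcd
    refine ⟨h3, fun h => ?_, fun h => ?_⟩
    · obtain ⟨T, hT, hTe⟩ := isTriangle_of_adj (adj he) (adj hbd) (adj hac).symm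
      refine ⟨T, hT, ?_⟩
      rw [hTe, ← Finset.eq_of_subset_of_card_le hsub (by omega), Sym2.eq_swap (a := c)]
      ext x
      simp
      tauto
    -- A fourth edge beyond the triangle would, by evenness, have both ends among `a`, `b`, `c`, and
    -- so already be one of its edges.
    · exfalso
      obtain ⟨e, heK, hen⟩ := Finset.exists_mem_notMem_of_card_lt_card
        (show ({s(a, b), s(a, c), s(b, c)} : Finset (Sym2 V)).card < K.card by omega)
      have hKe : insert e {s(a, b), s(a, c), s(b, c)} = K :=
        Finset.eq_of_subset_of_card_le (Finset.insert_subset heK hsub)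
          (by rw [Finset.card_insert_of_notMem hen]; omega)
      have hend : ∀ x ∈ e, x = a ∨ x = b ∨ x = c := by
        intro x hx
        obtain ⟨y, rfl⟩ := Sym2.mem_iff_exists.1 hx
        obtain ⟨z, hzy, hz⟩ := exists_other_edge hK heK
        rw [← hKe] at hz
        simp only [Finset.mem_insert, Finset.mem_singleton, Sym2.eq_iff] at hz
        grind
      induction e using Sym2.ind with
      | _ x y =>
      have hx := hend x (Sym2.mem_mk_left x y)
      have hy := hend y (Sym2.mem_mk_right x y)
      have hxy := (adj heK).ne
      simp only [Finset.mem_insert, Finset.mem_singleton, Sym2.eq_iff] at hen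
      grind
  · obtain ⟨x, hxa, hcx⟩ := exists_other_edge hK (Sym2.eq_swap ▸ hac : s(c, a) ∈ K)
    obtain ⟨y, hyb, hdy⟩ := exists_other_edge hK (Sym2.eq_swap ▸ hbd : s(d, b) ∈ K)
    have hxn : s(c, x) ∉ ({s(a, b), s(a, c), s(b, d)} : Finset (Sym2 V)) := by
      simp only [Finset.mem_insert, Finset.mem_singleton, Sym2.eq_iff]
      grind
    have h4 : 4 ≤ K.card := by
      have := Finset.card_le_card (Finset.insert_subset hcx hsub)
      rwa [Finset.card_insert_of_notMem hxn, hcard] at this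
    refine ⟨h3, fun h => by omega, fun h => ?_⟩
    have hKe : insert s(c, x) {s(a, b), s(a, c), s(b, d)} = K :=
      Finset.eq_of_subset_of_card_le (Finset.insert_subset hcx hsub)
        (by rw [Finset.card_insert_of_notMem hxn]; omega)
    -- Among the four edges only `s(c, x)` can be the second one at `d`.
    have hdx : d = x := by
      rw [← hKe] at hdy
      simp only [Finset.mem_insert, Finset.mem_singleton, Sym2.eq_iff] at hdy
      grind
    subst hdx
    obtain ⟨C, hC, hCe⟩ := isCycleOfLength_four_of_adj (adj he) (adj hbd) (adj hcx).symm
      (adj hac).symm hda.symm hcb.symm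
    refine ⟨C, hC, ?_⟩
    rw [hCe, ← hKe, Sym2.eq_swap (a := d), Sym2.eq_swap (a := c) (b := a)]
    ext z
    simp
    tauto

/-- No two triangles have a common vertex. -/
def DisjointTriangles (G : SimpleGraph V) : Prop :=
  ∀ T₁ T₂ : G.Subgraph, IsTriangle T₁ → IsTriangle T₂ → T₁ ≠ T₂ → ¬ Intersecting T₁ T₂

/-- Every triangle is adjacent to at most one cycle of length four. -/
def FewAdjacentFourCycles (G : SimpleGraph V) : Prop :=
  ∀ T C₁ C₂ : G.Subgraph, IsTriangle T → IsCycleOfLength 4 C₁ → IsCycleOfLength 4 C₂ →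
    Adjacent T C₁ → Adjacent T C₂ → C₁ = C₂

open Classical in
/-- The number of triangular faces is at most the total excess over four of the larger faces. -/
theorem card_triangles_le_sum {F : Type*} [Fintype F] [Fintype V] (bd : F → Finset (Sym2 V))
    (hG : ∀ f, ∀ e ∈ bd f, e ∈ G.edgeSet) (hne : ∀ f, (bd f).Nonempty)
    (htwo : ∀ e ∈ G.edgeSet, (Finset.univ.filter fun f => e ∈ bd f).card = 2)
    (hone : ∀ f g, f ≠ g → ∀ e e', e ∈ bd f → e ∈ bd g → e' ∈ bd f → e' ∈ bd g → e = e')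
    (heven : ∀ f u, Even ((bd f).filter fun e => u ∈ e).card)
    (hT : DisjointTriangles G) (hC : FewAdjacentFourCycles G) :
    (Finset.univ.filter fun f => (bd f).card = 3).card ≤
      ∑ g with 5 ≤ (bd g).card, ((bd g).card - 4) := by
  have h3 := fun f => three_le_card_of_even (hG f) (hne f) (heven f)
  -- Equal boundaries would give two faces with at least three common edges.
  have hinj : ∀ f g, bd f = bd g → f = g := by
    intro f g h
    by_contra hfg
    obtain ⟨e, he, e', he', hee⟩ := Finset.one_lt_card.1
      (show 1 < (bd f).card from lt_of_lt_of_le (by norm_num) (h3 f).1)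
    exact hee (hone f g hfg e e' he (h ▸ he) he' (h ▸ he'))
  have hdisj : ∀ f f', (bd f).card = 3 → (bd f').card = 3 → f ≠ f' →
      ∀ e ∈ bd f, ∀ e' ∈ bd f', ∀ u ∈ e, u ∉ e' := by
    intro f f' hf hf' hff e he e' he' u hu hu'
    obtain ⟨T, hT1, hT2⟩ := (h3 f).2.1 hf
    obtain ⟨T', hT1', hT2'⟩ := (h3 f').2.1 hf'
    refine hT T T' hT1 hT1' ?_ ⟨u, ?_, ?_⟩
    · rintro rfl
      exact hff (hinj f f' (Finset.coe_injective (hT2.symm.trans hT2')))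
    · exact T.mem_verts_of_mem_edge (by rw [hT2]; exact he) hu
    · exact T'.mem_verts_of_mem_edge (by rw [hT2']; exact he') hu'
  set R : F → F → Prop := fun f g => f ≠ g ∧ ∃ e, e ∈ bd f ∧ e ∈ bd g with hR
  -- `φ e` is the face across the edge `e` of the triangle `f`. Different edges lead to different
  -- faces; of the three, none is a triangle and at most one is a 4-cycle.
  have hlow : ∀ f ∈ Finset.univ.filter (fun f => (bd f).card = 3),
      2 ≤ (Finset.bipartiteAbove R (Finset.univ.filter fun g => 5 ≤ (bd g).card) f).card := by
    intro f hf
    replace hf : (bd f).card = 3 := (Finset.mem_filter.1 hf).2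
    have hother : ∀ e ∈ bd f, ∃ g, f ≠ g ∧ e ∈ bd g := by
      intro e he
      obtain ⟨g, hg, hgf⟩ := Finset.exists_mem_ne
        (show 1 < (Finset.univ.filter fun f => e ∈ bd f).card by rw [htwo e (hG f e he)]; norm_num) f
      exact ⟨g, hgf.symm, (Finset.mem_filter.1 hg).2⟩
    have : Nonempty F := ⟨f⟩
    choose! φ hφ1 hφ2 using hother
    have hφinj : Set.InjOn φ (bd f : Set (Sym2 V)) := by
      intro e he e' he' h
      exact hone f (φ e) (hφ1 e he) e e' he (hφ2 e he) he' (h ▸ hφ2 e' he')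
    have hφ3 : ∀ e ∈ bd f, (bd (φ e)).card ≠ 3 := by
      intro e he h
      have : ∃ u, u ∈ e := by
        induction e using Sym2.ind with
        | _ a b => exact ⟨a, Sym2.mem_mk_left a b⟩
      obtain ⟨u, hu⟩ := this
      exact hdisj f (φ e) hf h (hφ1 e he) e he e (hφ2 e he) u hu hu
    have hfour : ((bd f).filter fun e => (bd (φ e)).card = 4).card ≤ 1 := by
      rw [Finset.card_le_one]
      intro e he e' he'
      obtain ⟨he, h4⟩ := Finset.mem_filter.1 he
      obtain ⟨he', h4'⟩ := Finset.mem_filter.1 he'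
      obtain ⟨T, hT1, hT2⟩ := (h3 f).2.1 hf
      obtain ⟨C, hC1, hC2⟩ := (h3 _).2.2 h4
      obtain ⟨C', hC1', hC2'⟩ := (h3 _).2.2 h4'
      have := hC T C C' hT1 hC1 hC1' ⟨e, by rw [hT2]; exact he, by rw [hC2]; exact hφ2 e he⟩
        ⟨e', by rw [hT2]; exact he', by rw [hC2']; exact hφ2 e' he'⟩
      subst this
      exact hφinj he he' (hinj _ _ (Finset.coe_injective (hC2.symm.trans hC2')))
    have hfive : ((bd f).filter fun e => ¬ (bd (φ e)).card = 4).card ≤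
        (Finset.bipartiteAbove R (Finset.univ.filter fun g => 5 ≤ (bd g).card) f).card := by
      refine Finset.card_le_card_of_injOn φ ?_ (hφinj.mono fun x hx => (Finset.mem_filter.1 hx).1)
      intro e he
      obtain ⟨he, h4⟩ := Finset.mem_filter.1 he
      have h5 := hφ3 e he
      have h6 := (h3 (φ e)).1
      simp only [Finset.mem_coe, Finset.mem_bipartiteAbove, Finset.mem_filter, Finset.mem_univ,
        true_and]
      exact ⟨by omega, hφ1 e he, e, he, hφ2 e he⟩
    have := Finset.card_filter_add_card_filter_not (s := bd f) fun e => (bd (φ e)).card = 4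
    omega
  -- Triangular neighbours of `g` occupy edges of `bd g` with disjoint pairs of ends, and each end
  -- has degree at least two in `bd g`. Comparing with the degree sum gives `4 * N.card ≤ 2 * (bd
  -- g).card`, which suffices for integers once the length is at least five.
  have hhigh : ∀ g ∈ Finset.univ.filter (fun g => 5 ≤ (bd g).card),
      (Finset.bipartiteBelow R (Finset.univ.filter fun f => (bd f).card = 3) g).card ≤
        2 * ((bd g).card - 4) := by
    intro g hg
    replace hg : 5 ≤ (bd g).card := (Finset.mem_filter.1 hg).2
    set N := Finset.bipartiteBelow R (Finset.univ.filter fun f => (bd f).card = 3) g with hN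
    have hNmem : ∀ f ∈ N, (bd f).card = 3 ∧ f ≠ g ∧ ∃ e, e ∈ bd f ∧ e ∈ bd g := by
      intro f hf
      obtain ⟨h1, h2⟩ := (Finset.mem_bipartiteBelow R).1 hf
      exact ⟨(Finset.mem_filter.1 h1).2, h2⟩
    have : Nonempty (Sym2 V) := ⟨(hne g).choose⟩
    choose! ψ hψ1 hψ2 using fun f hf => (hNmem f hf).2.2
    have hdeg : ∀ e ∈ bd g, ∀ u ∈ e, 2 ≤ ((bd g).filter fun e => u ∈ e).card := by
      intro e he u hu
      have := Finset.card_pos.2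
        ⟨e, (Finset.mem_filter (p := fun e => u ∈ e)).2 ⟨he, hu⟩⟩
      obtain ⟨k, hk⟩ := heven g u
      omega
    have hends : ∀ e ∈ bd g, (Finset.univ.filter fun u => u ∈ e).card = 2 := by
      intro e he
      have hd := SimpleGraph.not_isDiag_of_mem_edgeSet G (hG g e he)
      rw [← Sym2.card_toFinset_of_not_isDiag e hd]
      congr 1
      ext u
      simp
    have hsum : ∑ u, ((bd g).filter fun e => u ∈ e).card = 2 * (bd g).card := by
      have := Finset.sum_card_bipartiteAbove_eq_sum_card_bipartiteBelow
        (s := (Finset.univ : Finset V)) (t := bd g) fun u e => u ∈ e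
      simp only [Finset.bipartiteAbove, Finset.bipartiteBelow] at this
      rw [this, Finset.sum_congr rfl hends, Finset.sum_const, smul_eq_mul, mul_comm]
    have hbU : (N : Set F).PairwiseDisjoint fun f => Finset.univ.filter fun u => u ∈ ψ f := by
      intro f hf f' hf' hff
      refine Finset.disjoint_left.2 fun u hu hu' => ?_
      exact hdisj f f' (hNmem f hf).1 (hNmem f' hf').1 hff _ (hψ1 f hf) _ (hψ1 f' hf') u
        (Finset.mem_filter.1 hu).2 (Finset.mem_filter.1 hu').2
    have h4 : N.card * 4 ≤ 2 * (bd g).card := by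
      rw [← hsum]
      calc N.card * 4 = ∑ f ∈ N, 4 := by rw [Finset.sum_const, smul_eq_mul]
        _ ≤ ∑ f ∈ N, ∑ u with u ∈ ψ f, ((bd g).filter fun e => u ∈ e).card := by
          refine Finset.sum_le_sum fun f hf => ?_
          calc 4 = ∑ u with u ∈ ψ f, 2 := by
                rw [Finset.sum_const, hends _ (hψ2 f hf), smul_eq_mul]
            _ ≤ _ := Finset.sum_le_sum fun u hu =>
                hdeg _ (hψ2 f hf) u (Finset.mem_filter.1 hu).2
        _ = ∑ u ∈ N.biUnion fun f => Finset.univ.filter fun u => u ∈ ψ f,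
            ((bd g).filter fun e => u ∈ e).card := (Finset.sum_biUnion hbU).symm
        _ ≤ _ := Finset.sum_le_sum_of_subset (Finset.subset_univ _)
    omega
  -- Counting adjacent pairs of a triangular and a long face from both sides; the factor two in both
  -- bounds cancels.
  have hdc := Finset.sum_card_bipartiteAbove_eq_sum_card_bipartiteBelow
    (s := Finset.univ.filter fun f => (bd f).card = 3)
    (t := Finset.univ.filter fun g => 5 ≤ (bd g).card) R
  have h1 := Finset.card_nsmul_le_sum _ _ _ hlow
  have h2 := Finset.sum_le_sum hhigh
  rw [← Finset.mul_sum] at h2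
  rw [smul_eq_mul] at h1
  omega

open Classical in
/-- A plane graph with disjoint triangles, each adjacent to at most one cycle of length four, and
without cuts of less than three edges has at most `2 |V| - 4` edges. -/
theorem PlaneDrawing.ncard_edgeSet_add_four_le {V : Type u} {G : SimpleGraph V} [Finite V]
    [Nonempty V] (D : PlaneDrawing G) (hE : G.edgeSet.Nonempty)
    (hcut : ∀ S : Set V, S.Nonempty → Sᶜ.Nonempty → 3 ≤ (cutEdges G S).ncard)
    (hT : DisjointTriangles G) (hC : FewAdjacentFourCycles G) :
    G.edgeSet.ncard + 4 ≤ 2 * Nat.card V := by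
  have := Fintype.ofFinite V
  obtain ⟨F, _, bd, hcard, hG, hne, htwo, hone, heven⟩ := D.exists_faces hE hcut
  have h3 := fun f => (three_le_card_of_even (hG f) (hne f) (heven f)).1
  have hmain := card_triangles_le_sum bd hG hne htwo hone heven hT hC
  have hsum : ∑ f, (bd f).card = 2 * G.edgeSet.ncard := by
    have h := Finset.sum_card_bipartiteAbove_eq_sum_card_bipartiteBelow
      (s := (Finset.univ : Finset F)) (t := G.edgeFinset) fun f e => e ∈ bd f
    have h1 : ∀ f, Finset.bipartiteAbove (fun f e => e ∈ bd f) G.edgeFinset f = bd f := by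
      intro f
      ext e
      simp only [Finset.mem_bipartiteAbove, SimpleGraph.mem_edgeFinset]
      exact ⟨fun h => h.2, fun h => ⟨hG f e h, h⟩⟩
    have h2 : ∀ e ∈ G.edgeFinset,
        (Finset.bipartiteBelow (fun f e => e ∈ bd f) Finset.univ e).card = 2 :=
      fun e he => htwo e (SimpleGraph.mem_edgeFinset.1 he)
    rw [Finset.sum_congr rfl h2, Finset.sum_const, smul_eq_mul] at h
    simp only [h1] at h
    rw [h, mul_comm, ← SimpleGraph.coe_edgeFinset, Set.ncard_coe_finset]
  -- Each face length is four, minus one for a triangle, plus the excess for a long face. Summed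
  -- with `hmain` this gives `4|F| ≤ 2|E|`.
  have hpt : ∀ f, 4 + (if 5 ≤ (bd f).card then (bd f).card - 4 else 0) =
      (bd f).card + (if (bd f).card = 3 then 1 else 0) := by
    intro f
    have := h3 f
    split_ifs <;> omega
  have hall := Finset.sum_congr (rfl : (Finset.univ : Finset F) = _) fun f _ => hpt f
  rw [Finset.sum_add_distrib, Finset.sum_add_distrib, hsum, ← Finset.sum_filter,
    Finset.sum_boole, Finset.sum_const, Finset.card_univ, smul_eq_mul] at hall
  simp only [Nat.cast_id] at hall
  rw [Nat.card_eq_fintype_card]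
  omega

end PlanarMad

/-! ### Induced subgraphs and the induction over small cuts -/

namespace PlanarMad

section Comap

variable {V V' : Type*} {G : SimpleGraph V} {H : SimpleGraph V'}

/-- The drawing of a graph induced by an injective homomorphism into a plane graph. -/
def PlaneDrawing.comap (D : PlaneDrawing G) (f : H →g G) (hf : Function.Injective f) :
    PlaneDrawing H where
  point := D.point ∘ f
  point_injective := D.point_injective.comp hf
  arc e := D.arc (f.mapEdgeSet e)
  arc_ends e := by
    rw [D.arc_ends, SimpleGraph.Hom.mapEdgeSet_coe, Sym2.map_map]
  mem_of_point_mem_arc e v h := by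
    have := D.mem_of_point_mem_arc _ _ h
    rw [SimpleGraph.Hom.mapEdgeSet_coe, Sym2.mem_map] at this
    obtain ⟨w, hw, hwv⟩ := this
    exact hf hwv ▸ hw
  arc_inter e e' hne x hx hx' := by
    obtain ⟨v, h1, h2, rfl⟩ := D.arc_inter _ _
      ((SimpleGraph.Hom.mapEdgeSet.injective f hf).ne hne) x hx hx'
    rw [SimpleGraph.Hom.mapEdgeSet_coe, Sym2.mem_map] at h1 h2
    obtain ⟨w, hw, rfl⟩ := h1
    obtain ⟨w', hw', h⟩ := h2
    exact ⟨w, hw, hf h ▸ hw', rfl⟩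

theorem subgraph_map_injective (f : H →g G) (hf : Function.Injective f) :
    Function.Injective (SimpleGraph.Subgraph.map f) := by
  intro A B h
  have hv : A.verts = B.verts := hf.image_injective (congrArg SimpleGraph.Subgraph.verts h)
  have he : A.edgeSet = B.edgeSet := by
    have := congrArg SimpleGraph.Subgraph.edgeSet h
    rw [SimpleGraph.Subgraph.edgeSet_map, SimpleGraph.Subgraph.edgeSet_map] at this
    exact (Sym2.map.injective hf).image_injective this
  refine SimpleGraph.Subgraph.ext hv ?_
  ext a b
  rw [← SimpleGraph.Subgraph.mem_edgeSet, he, SimpleGraph.Subgraph.mem_edgeSet]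

theorem IsCycleOfLength.map {k : ℕ} {C : H.Subgraph} (hC : IsCycleOfLength k C) (f : H →g G)
    (hf : Function.Injective f) : IsCycleOfLength k (C.map f) := by
  obtain ⟨u, w, hw, hk, rfl⟩ := hC
  exact ⟨f u, w.map f, hw.map hf, by rw [SimpleGraph.Walk.length_map, hk],
    (SimpleGraph.Walk.toSubgraph_map f w).symm⟩

theorem Adjacent.map {A B : H.Subgraph} (h : Adjacent A B) (f : H →g G) :
    Adjacent (A.map f) (B.map f) := by
  obtain ⟨e, h1, h2⟩ := h
  refine ⟨Sym2.map f e, ?_, ?_⟩ <;> rw [SimpleGraph.Subgraph.edgeSet_map]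
  exacts [⟨e, h1, rfl⟩, ⟨e, h2, rfl⟩]

theorem DisjointTriangles.comap (hG : DisjointTriangles G) (f : H →g G)
    (hf : Function.Injective f) : DisjointTriangles H := by
  rintro A B hA hB hne ⟨v, h1, h2⟩
  exact hG _ _ (IsCycleOfLength.map hA f hf) (IsCycleOfLength.map hB f hf)
    ((subgraph_map_injective f hf).ne hne) ⟨f v, ⟨v, h1, rfl⟩, ⟨v, h2, rfl⟩⟩

theorem FewAdjacentFourCycles.comap (hG : FewAdjacentFourCycles G) (f : H →g G)
    (hf : Function.Injective f) : FewAdjacentFourCycles H := by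
  intro T A B hT hA hB hTA hTB
  exact subgraph_map_injective f hf (hG _ _ _ (IsCycleOfLength.map hT f hf) (hA.map f hf)
    (hB.map f hf) (hTA.map f) (hTB.map f))

end Comap

theorem mem_image_edgeSet_induce {V : Type*} {G : SimpleGraph V} {S : Set V} {a b : V}
    (ha : a ∈ S) (hb : b ∈ S) (h : G.Adj a b) :
    s(a, b) ∈ Sym2.map Subtype.val '' (G.induce S).edgeSet :=
  ⟨s(⟨a, ha⟩, ⟨b, hb⟩), h, rfl⟩

theorem ncard_edgeSet_le_induce_add_cutEdges {V : Type*} [Finite V] (G : SimpleGraph V)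
    (S : Set V) : G.edgeSet.ncard ≤ (G.induce S).edgeSet.ncard + (G.induce Sᶜ).edgeSet.ncard +
      (cutEdges G S).ncard := by
  have hsub : G.edgeSet ⊆ Sym2.map Subtype.val '' (G.induce S).edgeSet ∪
      Sym2.map Subtype.val '' (G.induce Sᶜ).edgeSet ∪ cutEdges G S := by
    intro e he
    induction e using Sym2.ind with
    | _ a b =>
      by_cases ha : a ∈ S <;> by_cases hb : b ∈ S
      · exact Or.inl (Or.inl (mem_image_edgeSet_induce ha hb he))
      · exact Or.inr ⟨a, ha, b, hb, he, rfl⟩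
      · exact Or.inr ⟨b, hb, a, ha, SimpleGraph.Adj.symm he, Sym2.eq_swap⟩
      · exact Or.inl (Or.inr (mem_image_edgeSet_induce ha hb he))
  have h1 := Set.ncard_le_ncard hsub
  have h2 := Set.ncard_union_le (Sym2.map Subtype.val '' (G.induce S).edgeSet ∪
      Sym2.map Subtype.val '' (G.induce Sᶜ).edgeSet) (cutEdges G S)
  have h3 := Set.ncard_union_le (Sym2.map Subtype.val '' (G.induce S).edgeSet)
      (Sym2.map Subtype.val '' (G.induce Sᶜ).edgeSet)
  have h4 := Set.ncard_image_le (f := Sym2.map Subtype.val) (G.induce S).edgeSet.toFinite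
  have h5 := Set.ncard_image_le (f := Sym2.map Subtype.val) (G.induce Sᶜ).edgeSet.toFinite
  omega

/-- A plane graph with disjoint triangles, each adjacent to at most one cycle of length four, has
at most `2 |V| - 2` edges. -/
theorem PlaneDrawing.ncard_edgeSet_add_two_le {V : Type u} [Finite V] [Nonempty V]
    {G : SimpleGraph V} (D : PlaneDrawing G) (hT : DisjointTriangles G)
    (hC : FewAdjacentFourCycles G) : G.edgeSet.ncard + 2 ≤ 2 * Nat.card V := by
  induction hn : Nat.card V using Nat.strong_induction_on generalizing V with
  | _ n ih =>
  subst hn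
  by_cases hcut : ∀ S : Set V, S.Nonempty → Sᶜ.Nonempty → 3 ≤ (cutEdges G S).ncard
  -- The edgeless case, which includes a single vertex, is separate: the bound `2|V| - 4` fails for
  -- one vertex.
  · rcases G.edgeSet.eq_empty_or_nonempty with hE | hE
    · rw [hE, Set.ncard_empty]
      have := Nat.card_pos (α := V)
      omega
    · have := D.ncard_edgeSet_add_four_le hE hcut hT hC
      omega
  · push Not at hcut
    obtain ⟨S, hS, hS', hlt⟩ := hcut
    have hcard := Set.ncard_add_ncard_compl S
    have hpos := (Set.ncard_pos).2 hS
    have hpos' := (Set.ncard_pos).2 hS'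
    have hind : ∀ R : Set V, R.Nonempty → R.ncard < Nat.card V →
        (G.induce R).edgeSet.ncard + 2 ≤ 2 * R.ncard := by
      intro R hR hlt
      have : Nonempty R := hR.to_subtype
      have hf : Function.Injective (SimpleGraph.Embedding.induce (G := G) R).toHom :=
        (SimpleGraph.Embedding.induce (G := G) R).injective
      exact ih _ hlt (D.comap _ hf) (hT.comap _ hf) (hC.comap _ hf) (Nat.card_coe_set_eq R)
    have h1 := hind S hS (by omega)
    have h2 := hind Sᶜ hS' (by omega)
    have h3 := ncard_edgeSet_le_induce_add_cutEdges G S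
    -- The constant two is what makes the induction close: two parts save four, and the cut returns
    -- at most two.
    omega

end PlanarMad

/-! ### The maximum average degree -/

theorem theorem3p2 {V : Type*} [Finite V] (G : SimpleGraph V)
    (hplanar : PlanarMad.IsPlanar G)
    (htriangles : ∀ T₁ T₂ : G.Subgraph, PlanarMad.IsTriangle T₁ → PlanarMad.IsTriangle T₂ →
      T₁ ≠ T₂ → ¬ PlanarMad.Intersecting T₁ T₂)
    (hfour : ∀ T : G.Subgraph, PlanarMad.IsTriangle T →
      {C : G.Subgraph | PlanarMad.IsCycleOfLength 4 C ∧ PlanarMad.Adjacent T C}.encard ≤ 1) :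
    PlanarMad.mad G < 4 := by
  obtain ⟨D⟩ := hplanar
  -- Without vertices the supremum is over the empty set and equals zero by convention.
  rcases isEmpty_or_nonempty V with hV | hV
  · have : {d : ℝ | ∃ H : G.Subgraph, H.verts.Nonempty ∧ d = PlanarMad.averageDegree H} = ∅ :=
      Set.eq_empty_of_forall_notMem fun d ⟨H, ⟨v, _⟩, _⟩ => hV.elim v
    rw [PlanarMad.mad, this, Real.sSup_empty]
    norm_num
  obtain ⟨H, hH, hmad⟩ := (PlanarMad.isGreatest_mad G).1
  have hC : PlanarMad.FewAdjacentFourCycles G := fun T C₁ C₂ hT h1 h2 h3 h4 =>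
    Set.encard_le_one_iff.1 (hfour T hT) C₁ C₂ ⟨h1, h3⟩ ⟨h2, h4⟩
  have : Nonempty H.verts := hH.to_subtype
  have hf : Function.Injective (SimpleGraph.Embedding.induce (G := G) H.verts).toHom :=
    (SimpleGraph.Embedding.induce (G := G) H.verts).injective
  have hbound := (D.comap _ hf).ncard_edgeSet_add_two_le
    (PlanarMad.DisjointTriangles.comap htriangles _ hf) (hC.comap _ hf)
  -- The bound is applied to the subgraph induced on the vertices of an extremal `H`, which has at
  -- least as many edges.
  have hsub : H.edgeSet ⊆ Sym2.map Subtype.val '' (G.induce H.verts).edgeSet := by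
    intro e he
    induction e using Sym2.ind with
    | _ a b =>
      have hab : H.Adj a b := he
      exact PlanarMad.mem_image_edgeSet_induce hab.fst_mem hab.snd_mem hab.adj_sub
  have h1 := Set.ncard_le_ncard hsub
  have h2 := Set.ncard_image_le (f := Sym2.map Subtype.val)
    (G.induce H.verts).edgeSet.toFinite
  have h3 : H.edgeSet.ncard + 2 ≤ 2 * H.verts.ncard := by
    rw [← Nat.card_coe_set_eq H.verts]
    omega
  have h4 : (0 : ℝ) < H.verts.ncard := by exact_mod_cast (Set.ncard_pos).2 hH
  have h5 : (H.edgeSet.ncard : ℝ) + 2 ≤ 2 * H.verts.ncard := by exact_mod_cast h3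
  rw [hmad, PlanarMad.averageDegree, div_lt_iff₀ h4]
  linarith
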